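/- Consider the classical M/G/1 retrial queue without waiting room: customers arrive according to a Poisson process with rate $\lambda_2>0$; an arriving customer who finds the server free starts service, otherwise joins the orbit; each customer in orbit retries independently after exponential times with rate $\nu>0$ and starts service if the server is then free. Service times are i.i.d. with a distribution $B$ on $(0,\infty)$, with Laplace--Stieltjes transform $B^*(s)=\int e^{-sx}\,dB(x)$. Put $R_B=\sup\{\theta:\int e^{\theta x}dB(x)<\infty\}\in[0,\infty]$ and assume that $B$ is of type 1, i.e. $R_B>0$ and $B^*(-\theta)\to\infty$ as $\theta\uparrow R_B$. Let $b=\int x\,dB(x)$, $\rho_2=\lambda_2 b$, and assume $\rho_2<1$. In the stationary regime let $q(n)$, $r(n)$ and $p_2(n)$ be the probabilities that $n$ customers are in orbit and the server is free, that $n$ customers are in orbit and the server is busy, and that $n$ customers are in orbit, respectively. Let $Q(z)=\sum_n q(n)z^n$, $R(z)=\sum_n r(n)z^n$, $P_2(z)=\sum_n p_2(n)z^n$ and $$f_1(z)=\frac{1-B^*(\lambda_2(1-z))}{B^*(\lambda_2(1-z))-z}.$$ Then $B^*(\lambda_2(1-z))-z$ has a smallest real zero $R^*>1$ (among the $z>1$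 with $\int e^{\lambda_2(z-1)x}dB(x)<\infty$). The point $R^*$ is a simple pole of $f_1$, and it is the unique dominant singularity of each of $f_1$, $Q$, $R$ and $P_2$: each of these functions, given near $0$, continues analytically to every point of the closed disc $|z|\le R^*$ except $R^*$, and does not continue analytically to $R^*$. Moreover, with $$c=\frac{1-R^*}{1+\lambda_2 {B^*}'(\lambda_2(1-R^*))}>0,$$ $$c_Q=(1-\rho_2)(R^*-1)^{\frac{\lambda_2}{\nu}c}\exp\left(-\frac{\lambda_2}{\nu}\int_{R^*}^1\left(\frac{1-B^*(\lambda_2(1-x))}{B^*(\lambda_2(1-x))-x}-\frac{c}{R^*-x}\right)dx\right),$$ where the integral converges, one has, as $n\to\infty$, $$q(n)\sim\frac{c_Q}{\Gamma\left(\frac{\lambda_2}{\nu}c\right)}\,n^{\frac{\lambda_2}{\nu}c-1}(R^*)^{-n-\frac{\lambda_2}{\nu}c},$$ $$r(n)\sim\frac{c_Q\,c}{\Gamma\left(1+\frac{\lambda_2}{\nu}c\right)}\,n^{\frac{\lambda_2}{\nu}c}(R^*)^{-n-1-\frac{\lambda_2}{\nu}c},\qquad p_2(n)\sim\frac{c_Q\,c}{\Gamma\left(1+\frac{\lambda_2}{\nu}c\right)}\,n^{\frac{\lambda_2}{\nu}c}(R^*)^{-n-1-\frac{\lambda_2}{\nu}c}.$$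 -/

import Mathlib

open MeasureTheory ProbabilityTheory Filter Topology Asymptotics

namespace RetrialQueue

noncomputable section

/-! ### Service times -/

/-- The Laplace-Stieltjes transform `B*(s) = ∫ e^{-s x} dB(x)` at a real argument. -/
def lst (B : Measure ℝ) (s : ℝ) : ℝ := mgf id B (-s)

/-- The Laplace-Stieltjes transform `B*(s) = ∫ e^{-s x} dB(x)` at a complex argument. -/
def clst (B : Measure ℝ) (s : ℂ) : ℂ := complexMGF id B (-s)

/-- `R_B = sup {θ | ∫ e^{θ x} dB(x) < ∞} ∈ [0, ∞]`, so that `-R_B` is the abscissa of convergence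
of the transform, hence its dominant singularity (`R_B = ∞` when the transform is entire). -/
def lstRadius (B : Measure ℝ) : EReal := ⨆ θ ∈ integrableExpSet id B, ((θ : ℝ) : EReal)

/-- Type-1 service time distributions: `R_B > 0` and `B*(-θ) → ∞` as `θ ↑ R_B`. -/
def IsTypeOne (B : Measure ℝ) : Prop :=
  0 < lstRadius B ∧
    Tendsto (fun θ : ℝ => lst B (-θ))
      (comap (fun θ : ℝ => (θ : EReal)) (𝓝[<] (lstRadius B))) atTop

/-! ### The M/G/1 retrial queue and its stationary law -/

/-- States of the queue: `Sum.inl n` means that the server is free and `n` customers are in orbit;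
`Sum.inr (n, x)` means that the server is busy with a customer whose residual service time is
`x > 0` and that `n` customers are in orbit. -/
abbrev State : Type := ℕ ⊕ (ℕ × Set.Ioi (0 : ℝ))

/-- The number of customers in orbit. -/
def orbit : State → ℕ
  | Sum.inl n => n
  | Sum.inr (n, _) => n

/-- Test functions on the state space: `φ n x` is the value at the busy state `(n, x)`, and
`φ n 0` is the value at the free state `n` (a service ends when the residual service time reaches
`0`, and the server then becomes free with the same orbit). For every `n` the function `φ n` is
bounded and continuously differentiable with bounded derivative on `[0, ∞)`, and it vanishes for
all but finitely many `n`. -/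
structure IsTestFunction (φ : ℕ → ℝ → ℝ) : Prop where
  contDiff : ∀ n, ContDiff ℝ 1 (φ n)
  bounded : ∀ n, ∃ C : ℝ, ∀ x : ℝ, 0 ≤ x → |φ n x| ≤ C ∧ |deriv (φ n) x| ≤ C
  finite : ∃ N : ℕ, ∀ n, N ≤ n → ∀ x, φ n x = 0

/-- The infinitesimal generator of the M/G/1 retrial queue with arrival rate `lam`, retrial rate
`nu` per customer in orbit and service time distribution `B`.
When the server is free and `n` customers are in orbit, an arrival (rate `lam`) starts a fresh
service, and a retrial (rate `n * nu`) starts a fresh service and removes a customer from the orbit.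
When the server is busy, the residual service time decreases at unit speed, and an arrival
(rate `lam`) joins the orbit. -/
def generator (lam nu : ℝ) (B : Measure ℝ) (φ : ℕ → ℝ → ℝ) : State → ℝ
  | Sum.inl n =>
      lam * ((∫ y, φ n y ∂B) - φ n 0) + (n : ℝ) * nu * ((∫ y, φ (n - 1) y ∂B) - φ n 0)
  | Sum.inr (n, x) =>
      -deriv (φ n) (x : ℝ) + lam * (φ (n + 1) (x : ℝ) - φ n (x : ℝ))

/-- `P` is a stationary law of the M/G/1 retrial queue: the generator has mean zero under `P`. -/
def IsStationary (lam nu : ℝ) (B : Measure ℝ) (P : Measure State) : Prop :=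
  ∀ φ : ℕ → ℝ → ℝ, IsTestFunction φ → ∫ s, generator lam nu B φ s ∂P = 0

/-- `q(n)`: the probability that `n` customers are in orbit and the server is free. -/
def qProb (P : Measure State) (n : ℕ) : ℝ := P.real {s | s.isLeft ∧ orbit s = n}

/-- `r(n)`: the probability that `n` customers are in orbit and the server is busy. -/
def rProb (P : Measure State) (n : ℕ) : ℝ := P.real {s | s.isRight ∧ orbit s = n}

/-- `p₂(n)`: the probability that `n` customers are in orbit. -/
def pProb (P : Measure State) (n : ℕ) : ℝ := P.real {s | orbit s = n}

/-- The (partial) probability generating function of a sequence of probabilities. -/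
def pgf (a : ℕ → ℝ) (z : ℂ) : ℂ := ∑' n, (a n : ℂ) * z ^ n

/-! ### Singularities and constants -/

/-- The function given by `f` near `0` has the positive real point `R` as its unique dominant
singularity: it continues analytically to all points of the closed disc of radius `R` other than
`R`, and it does not continue analytically to `R`. -/
def IsDominantSingularity (f : ℂ → ℂ) (R : ℝ) : Prop :=
  0 < R ∧ ∃ F : ℂ → ℂ,
    F =ᶠ[𝓝 0] f ∧
    (∀ z : ℂ, ‖z‖ ≤ R → z ≠ (R : ℂ) → AnalyticAt ℂ F z) ∧
    ¬ ∃ G : ℂ → ℂ, AnalyticAt ℂ G (R : ℂ) ∧ ∀ᶠ z in 𝓝 (R : ℂ), ‖z‖ < R → G z = F z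

/-- `f₁(z) = (1 - B*(λ₂(1 - z))) / (B*(λ₂(1 - z)) - z)` at a complex argument. -/
def f1 (lam : ℝ) (B : Measure ℝ) (z : ℂ) : ℂ :=
  (1 - clst B (lam * (1 - z))) / (clst B (lam * (1 - z)) - z)

/-- The zeros larger than `1` of `B*(λ₂(1 - z)) - z`, where `B*` is given by a convergent
integral. -/
def zerosAboveOne (lam : ℝ) (B : Measure ℝ) : Set ℝ :=
  {x | 1 < x ∧ lam * (x - 1) ∈ integrableExpSet id B ∧ lst B (lam * (1 - x)) - x = 0}

/-- The constant `c_{f₁}^{(1)}`. -/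
def cf1 (lam : ℝ) (B : Measure ℝ) (R : ℝ) : ℝ :=
  (1 - R) / (1 + lam * deriv (lst B) (lam * (1 - R)))

/-- The integrand in the constant `c_Q^{(1)}`. -/
def cQIntegrand (lam : ℝ) (B : Measure ℝ) (R x : ℝ) : ℝ :=
  (1 - lst B (lam * (1 - x))) / (lst B (lam * (1 - x)) - x) - cf1 lam B R / (R - x)

/-- The constant `c_Q^{(1)}`. -/
def cQ (lam nu : ℝ) (B : Measure ℝ) (R : ℝ) : ℝ :=
  (1 - lam * ∫ x, x ∂B) * (R - 1) ^ (lam / nu * cf1 lam B R) *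
    Real.exp (-(lam / nu) * ∫ x in R..1, cQIntegrand lam B R x)

end

end RetrialQueue

open RetrialQueue

/-! The proof turns stationarity into a linear differential equation for the generating functions
and reads the tails off its explicit solution.

Testing the generator against exponentials in the residual service time, one orbit level at a time,
gives two relations. At exponent 0 it gives the cut equation `cut_equation`, that is Q' = κ R(z)
with κ = λ₂/ν. At exponent λ₂(1 - x) the unknown transforms of the residual time cancel on
summation, and `generating_function_equation` leaves R(x) = f₁(x) Q(x) on [0, 1). Hence Q' = κ f₁ Q.

The singularities of f₁ come from the zeros of B*(λ₂(1 - z)) - z. A convex moment generating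
function whose slope at 0 is smaller than that of a line through (0, 1), but which overtakes the
line later, crosses it again transversally; this crossing is R* (`exists_mgf_eq`). Two modulus
estimates exclude every other zero in |z| ≤ R* except 1, where the numerator vanishes as well
(`exists_zero_arrivalGF`). So f₁ = c/(R* - z) + h with h holomorphic in a larger disc
(`exists_pole_decomposition`).

With H a primitive of h, the equation integrates to Q = K (1 - z/R*)^(-κc) exp(κH)
(`pgf_eventuallyEq`). Total mass one forces Q(1) = 1 - ρ₂, which determines K; the value of the
regular factor at R* is then `cQ` up to a power of R* (`amplitude_eq`). R and P₂ carry one more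
factor (1 - z/R*)⁻¹.

Finally, for (1 - z/R*)^(-γ) A(z) with A holomorphic beyond R* and A(R*) ≠ 0, no contour integration
is needed: the coefficients are a convolution of the binomial coefficients with an exponentially
small sequence, and dominated convergence gives `isEquivalent_coeff`. Only the equations satisfied
by the stationary law enter, not its existence or uniqueness. -/

namespace RetrialQueue

/-! ### Coefficient asymptotics at an algebraic singularity -/

/-- The Taylor coefficients of `(1 - z) ^ (-γ)`. -/
noncomputable def risingCoeff (γ : ℝ) (n : ℕ) : ℝ := ∏ j ∈ Finset.range n, (γ + j) / (j + 1)

lemma risingCoeff_succ (γ : ℝ) (n : ℕ) :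
    risingCoeff γ (n + 1) = risingCoeff γ n * ((γ + n) / (n + 1)) :=
  Finset.prod_range_succ _ _

lemma risingCoeff_pos {γ : ℝ} (hγ : 0 < γ) (n : ℕ) : 0 < risingCoeff γ n :=
  Finset.prod_pos fun j _ => by positivity

lemma choose_eq_risingCoeff (γ : ℝ) (n : ℕ) :
    Ring.choose ((γ : ℂ) + n - 1) n = (risingCoeff γ n : ℂ) := by
  have key : ∀ n : ℕ, (ascPochhammer ℂ n).eval (γ : ℂ) = n.factorial * (risingCoeff γ n : ℂ) := by
    intro n
    induction n with
    | zero => simp [risingCoeff]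
    | succ n ih =>
      rw [ascPochhammer_succ_eval, ih, risingCoeff_succ, Nat.factorial_succ]
      have : (n : ℂ) + 1 ≠ 0 := by exact_mod_cast n.succ_ne_zero
      push_cast
      field_simp
  have h := Ring.factorial_nsmul_multichoose_eq_ascPochhammer (γ : ℂ) n
  rw [Polynomial.ascPochhammer_smeval_eq_eval, key, nsmul_eq_mul] at h
  rw [← Ring.multichoose_eq]
  exact mul_left_cancel₀ (by exact_mod_cast n.factorial_ne_zero) h

lemma hasFPowerSeriesOnBall_one_sub_cpow (γ : ℝ) :
    HasFPowerSeriesOnBall (fun z : ℂ => (1 - z) ^ (-γ : ℂ))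
      (.ofScalars ℂ fun n => (risingCoeff γ n : ℂ)) 0 1 := by
  have h := Complex.one_div_one_sub_cpow_hasFPowerSeriesOnBall_zero (γ : ℂ)
  simpa only [choose_eq_risingCoeff, one_div, ← Complex.cpow_neg] using h

/-- This is Euler's limit for Γ: the product of the γ + j is `n.factorial * risingCoeff γ n`, and
`GammaSeq` has one factor more, compensated by n / (n + γ). -/
lemma tendsto_risingCoeff {γ : ℝ} (hγ : 0 < γ) :
    Tendsto (fun n : ℕ => risingCoeff γ n / (n : ℝ) ^ (γ - 1)) atTop (𝓝 (Real.Gamma γ)⁻¹) := by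
  have h1 := (Real.GammaSeq_tendsto_Gamma γ).inv₀ (Real.Gamma_pos_of_pos hγ).ne'
  have h2 : Tendsto (fun n : ℕ => (n : ℝ) / (n + γ)) atTop (𝓝 1) :=
    tendsto_natCast_div_add_atTop γ
  refine (by simpa using h1.mul h2 :
    Tendsto (fun n : ℕ => (Real.GammaSeq γ n)⁻¹ * (n / (n + γ))) atTop _).congr' ?_
  filter_upwards [eventually_gt_atTop 0] with n hn
  have hn' : (0 : ℝ) < n := by exact_mod_cast hn
  have hprod : ∀ m : ℕ, ∏ j ∈ Finset.range m, (γ + j) = m.factorial * risingCoeff γ m := by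
    intro m
    induction m with
    | zero => simp [risingCoeff]
    | succ m ih =>
      rw [Finset.prod_range_succ, ih, risingCoeff_succ, Nat.factorial_succ]
      push_cast
      field_simp
  have hf : (n.factorial : ℝ) ≠ 0 := by exact_mod_cast n.factorial_ne_zero
  have hp : (n : ℝ) ^ γ ≠ 0 := (Real.rpow_pos_of_pos hn' _).ne'
  rw [Real.GammaSeq, Finset.prod_range_succ, hprod, Real.rpow_sub_one hn'.ne']
  have : (n : ℝ) + γ ≠ 0 := by positivity
  have : γ + (n : ℝ) ≠ 0 := by positivity
  field_simp
  ring

/-- The recursion reads (n + 1) u(n + 1) = (γ + n) u(n) ≥ n u(n). The weight n is needed because u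
itself decreases when γ < 1. -/
lemma natCast_mul_risingCoeff_le {γ : ℝ} (hγ : 0 < γ) {m n : ℕ} (h : m ≤ n) :
    m * risingCoeff γ m ≤ n * risingCoeff γ n := by
  induction n, h using Nat.le_induction with
  | base => rfl
  | succ n _ ih =>
    refine ih.trans ?_
    rw [risingCoeff_succ]
    have := risingCoeff_pos hγ n
    have h1 : ((n + 1 : ℕ) : ℝ) * (risingCoeff γ n * ((γ + n) / (n + 1))) =
      (γ + n) * risingCoeff γ n := by
      push_cast
      field_simp
    rw [h1]
    nlinarith

/-- A majorant uniform in n, for dominated convergence. With m = n - k ≥ 1, monotonicity of n u(n)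
and k + m ≤ m (k + 1) give the factor k + 1; for k = n > 0 the bound u(1) = γ ≤ n u(n) is used
instead, whence the γ⁻¹. -/
lemma risingCoeff_sub_div_le {γ : ℝ} (hγ : 0 < γ) {k n : ℕ} (h : k ≤ n) :
    risingCoeff γ (n - k) / risingCoeff γ n ≤ (1 + γ⁻¹) * (k + 1) := by
  obtain ⟨m, rfl⟩ := Nat.exists_eq_add_of_le h
  rw [Nat.add_sub_cancel_left, div_le_iff₀ (risingCoeff_pos hγ _)]
  have hu := risingCoeff_pos hγ (k + m)
  have hγ' : 0 < γ⁻¹ := inv_pos.2 hγ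
  rcases Nat.eq_zero_or_pos m with rfl | hm
  · rcases Nat.eq_zero_or_pos k with rfl | hk
    · simp [risingCoeff, hγ.le]
    · have h1 := natCast_mul_risingCoeff_le hγ (show 1 ≤ k + 0 from hk)
      have h2 : risingCoeff γ 1 = γ := by simp [risingCoeff]
      rw [h2, Nat.cast_one, one_mul] at h1
      have h0 : risingCoeff γ 0 = 1 := by simp [risingCoeff]
      have h3 : 1 ≤ γ⁻¹ * (k * risingCoeff γ (k + 0)) := by
        have := mul_le_mul_of_nonneg_left h1 hγ'.le
        rw [inv_mul_cancel₀ hγ.ne'] at this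
        simpa using this
      rw [h0]
      have : 0 ≤ (k : ℝ) := by positivity
      nlinarith [mul_nonneg this hu.le, mul_pos hγ' hu]
  · have h1 := natCast_mul_risingCoeff_le hγ (show m ≤ k + m by omega)
    have hm' : (1 : ℝ) ≤ m := by exact_mod_cast hm
    have hk : 0 ≤ (k : ℝ) := by positivity
    have h2 : ((k + m : ℕ) : ℝ) ≤ m * (k + 1) := by push_cast; nlinarith
    have h3 : (m : ℝ) * risingCoeff γ m ≤ m * ((k + 1) * risingCoeff γ (k + m)) := by
      rw [← mul_assoc]
      exact h1.trans (mul_le_mul_of_nonneg_right h2 hu.le)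
    have h4 := le_of_mul_le_mul_left h3 (by linarith)
    have h5 : 0 ≤ γ⁻¹ * ((k + 1) * risingCoeff γ (k + m)) := by positivity
    linarith

lemma tendsto_risingCoeff_succ_div {γ : ℝ} (hγ : 0 < γ) :
    Tendsto (fun n : ℕ => risingCoeff γ n / risingCoeff γ (n + 1)) atTop (𝓝 1) := by
  have h : Tendsto (fun n : ℕ => ((n : ℝ) + γ) / (n + 1)) atTop (𝓝 1) := by
    have h1 : Tendsto (fun n : ℕ => (n : ℝ) / (n + 1)) atTop (𝓝 1) :=
      tendsto_natCast_div_add_atTop 1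
    have h2 : Tendsto (fun n : ℕ => γ * (1 / ((n : ℝ) + 1))) atTop (𝓝 (γ * 0)) :=
      tendsto_one_div_add_atTop_nhds_zero_nat.const_mul γ
    refine (by simpa using h1.add h2 : Tendsto (fun n : ℕ =>
      (n : ℝ) / (n + 1) + γ * (1 / ((n : ℝ) + 1))) atTop (𝓝 1)).congr fun n => ?_
    ring
  refine (by simpa using h.inv₀ one_ne_zero : Tendsto _ _ (𝓝 (1 : ℝ))).congr fun n => ?_
  have := (risingCoeff_pos hγ n).ne'
  rw [risingCoeff_succ]
  field_simp
  ring

lemma tendsto_risingCoeff_sub_div {γ : ℝ} (hγ : 0 < γ) (k : ℕ) :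
    Tendsto (fun n : ℕ => risingCoeff γ (n - k) / risingCoeff γ n) atTop (𝓝 1) := by
  rw [← tendsto_add_atTop_iff_nat k]
  simp only [Nat.add_sub_cancel]
  induction k with
  | zero =>
    refine tendsto_const_nhds.congr fun n => ?_
    rw [add_zero, div_self (risingCoeff_pos hγ _).ne']
  | succ k ih =>
    have := ih.mul ((tendsto_add_atTop_iff_nat k).2 (tendsto_risingCoeff_succ_div hγ))
    rw [one_mul] at this
    refine this.congr fun n => ?_
    have := (risingCoeff_pos hγ (n + k)).ne'
    rw [← add_assoc]
    field_simp

/-- Each ratio u(n - k) / u(n) tends to 1 and is dominated by a multiple of k + 1, so Tannery's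
theorem applies to the convolution. -/
lemma tendsto_sum_antidiagonal_div_risingCoeff {γ : ℝ} (hγ : 0 < γ) {α : ℕ → ℂ}
    (hα : Summable fun k : ℕ => ((k : ℝ) + 1) * ‖α k‖) :
    Tendsto (fun n : ℕ => (∑ kl ∈ Finset.HasAntidiagonal.antidiagonal n, α kl.1 * (risingCoeff γ kl.2 : ℂ)) /
      (risingCoeff γ n : ℂ)) atTop (𝓝 (∑' k, α k)) := by
  have key : ∀ n : ℕ, (∑ kl ∈ Finset.HasAntidiagonal.antidiagonal n, α kl.1 * (risingCoeff γ kl.2 : ℂ)) /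
      (risingCoeff γ n : ℂ) = ∑' k, if k ≤ n then
        α k * ((risingCoeff γ (n - k) / risingCoeff γ n : ℝ) : ℂ) else 0 := by
    intro n
    rw [tsum_eq_sum (s := Finset.range (n + 1)),
      Finset.Nat.sum_antidiagonal_eq_sum_range_succ_mk, Finset.sum_div]
    · refine Finset.sum_congr rfl fun k hk => ?_
      rw [if_pos (Nat.lt_succ_iff.1 (Finset.mem_range.1 hk))]
      push_cast
      ring
    · intro k hk
      rw [if_neg]
      simpa [Nat.lt_succ_iff] using hk
  simp only [key]
  refine tendsto_tsum_of_dominated_convergence (hα.mul_left (1 + γ⁻¹)) (fun k => ?_)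
    (Eventually.of_forall fun n k => ?_)
  · have h1 : Tendsto (fun n : ℕ => α k * ((risingCoeff γ (n - k) / risingCoeff γ n : ℝ) : ℂ))
        atTop (𝓝 (α k)) := by
      simpa using ((Complex.continuous_ofReal.tendsto _).comp
        (tendsto_risingCoeff_sub_div hγ k)).const_mul (α k)
    refine h1.congr' ?_
    filter_upwards [eventually_ge_atTop k] with n hn
    rw [if_pos hn]
  · have hγ' : 0 < γ⁻¹ := inv_pos.2 hγ
    split_ifs with h
    · rw [norm_mul, Complex.norm_real, Real.norm_of_nonneg
        (div_nonneg (risingCoeff_pos hγ _).le (risingCoeff_pos hγ _).le), mul_comm, ← mul_assoc]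
      exact mul_le_mul_of_nonneg_right (risingCoeff_sub_div_le hγ h) (norm_nonneg _)
    · rw [norm_zero]
      positivity

/-- A power series convergent in a disc of radius larger than `1` has absolutely summable
coefficients, with a weight. -/
lemma exists_coeff_of_differentiableOn {A : ℂ → ℂ} {r : ℝ} (hr : 1 < r)
    (hA : DifferentiableOn ℂ A (Metric.ball 0 r)) :
    ∃ α : ℕ → ℂ, (∀ z : ℂ, ‖z‖ < r → HasSum (fun k => α k * z ^ k) (A z)) ∧
      Summable fun k : ℕ => ((k : ℝ) + 1) * ‖α k‖ := by
  have hsum : ∀ z : ℂ, ‖z‖ < r →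
      HasSum (fun k : ℕ => (k.factorial : ℂ)⁻¹ * iteratedDeriv k A 0 * z ^ k) (A z) := by
    intro z hz
    have := Complex.hasSum_taylorSeries_on_ball hA (z := z) (by simpa using hz)
    have he : (fun k : ℕ => (k.factorial : ℂ)⁻¹ * iteratedDeriv k A 0 * z ^ k) =
        fun k : ℕ => (k.factorial : ℂ)⁻¹ • (z - 0) ^ k • iteratedDeriv k A 0 := by
      funext k
      simp only [sub_zero, smul_eq_mul]
      ring
    rw [he]
    exact this
  refine ⟨_, hsum, ?_⟩
  -- Convergence at a point t > 1 bounds the coefficients by a multiple of t⁻ᵏ, which absorbs the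
  -- weight k + 1.
  obtain ⟨t, h1t, htr⟩ := exists_between hr
  have ht0 : 0 < t := by linarith
  have hs := (hsum t (by simpa [abs_of_pos ht0] using htr)).summable.norm.tendsto_atTop_zero
  obtain ⟨C, hC⟩ := hs.bddAbove_range
  set α : ℕ → ℂ := fun k : ℕ => (k.factorial : ℂ)⁻¹ * iteratedDeriv k A 0
  have hb : ∀ k, ‖α k‖ ≤ C * t⁻¹ ^ k := by
    intro k
    have h := hC ⟨k, rfl⟩
    simp only [norm_mul, norm_pow, Complex.norm_real, Real.norm_of_nonneg ht0.le] at h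
    rw [inv_pow, ← div_eq_mul_inv, le_div_iff₀ (by positivity)]
    simpa [α] using h
  have hlt : ‖t⁻¹‖ < 1 := by
    rw [norm_inv, Real.norm_of_nonneg ht0.le]
    exact inv_lt_one_of_one_lt₀ h1t
  have hg := ((summable_pow_mul_geometric_of_norm_lt_one 1 hlt).add
    (summable_pow_mul_geometric_of_norm_lt_one 0 hlt)).mul_left C
  refine Summable.of_nonneg_of_le (fun k => by positivity) (fun k => ?_) hg
  have := mul_le_mul_of_nonneg_left (hb k) (show (0 : ℝ) ≤ k + 1 by positivity)
  refine this.trans (le_of_eq ?_)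
  ring

lemma coeff_asymptotics_one {A : ℂ → ℂ} {r γ : ℝ} (hr : 1 < r) (hγ : 0 < γ)
    (hA : DifferentiableOn ℂ A (Metric.ball 0 r)) {a : ℕ → ℂ}
    (ha : ∀ᶠ z : ℂ in 𝓝 0, HasSum (fun n => a n * z ^ n) ((1 - z) ^ (-γ : ℂ) * A z)) :
    Tendsto (fun n : ℕ => a n / ((n : ℝ) ^ (γ - 1) : ℝ)) atTop
      (𝓝 (A 1 / (Real.Gamma γ : ℝ))) := by
  obtain ⟨α, hα, hsum⟩ := exists_coeff_of_differentiableOn hr hA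
  have hu := hasFPowerSeriesOnBall_one_sub_cpow γ
  have hconv : ∀ᶠ z : ℂ in 𝓝 0, HasSum (fun n => (∑ kl ∈ Finset.HasAntidiagonal.antidiagonal n,
      α kl.1 * (risingCoeff γ kl.2 : ℂ)) * z ^ n) ((1 - z) ^ (-γ : ℂ) * A z) := by
    filter_upwards [Metric.ball_mem_nhds (0 : ℂ) one_pos] with z hz
    have hz1 : ‖z‖ < 1 := by simpa using hz
    have h1 := hα z (hz1.trans hr)
    have h2 : HasSum (fun n => (risingCoeff γ n : ℂ) * z ^ n) ((1 - z) ^ (-γ : ℂ)) := by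
      have := hu.hasSum (y := z) (by
        rw [← ENNReal.ofReal_one, Metric.eball_ofReal]; exact hz)
      simpa [FormalMultilinearSeries.ofScalars_apply_eq, mul_comm] using this
    have h3 := summable_norm_sum_mul_antidiagonal_of_summable_norm h1.summable.norm
      h2.summable.norm
    have h4 := tsum_mul_tsum_eq_tsum_sum_antidiagonal_of_summable_norm h1.summable.norm
      h2.summable.norm
    rw [h1.tsum_eq, h2.tsum_eq] at h4
    have h5 := h3.of_norm.hasSum
    rw [← h4, mul_comm (A z)] at h5
    have he : ∀ n, ∑ kl ∈ Finset.HasAntidiagonal.antidiagonal n,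
        α kl.1 * z ^ kl.1 * ((risingCoeff γ kl.2 : ℂ) * z ^ kl.2) =
        (∑ kl ∈ Finset.HasAntidiagonal.antidiagonal n,
          α kl.1 * (risingCoeff γ kl.2 : ℂ)) * z ^ n := by
      intro n
      rw [Finset.sum_mul]
      refine Finset.sum_congr rfl fun kl hkl => ?_
      rw [← Finset.HasAntidiagonal.mem_antidiagonal.1 hkl, pow_add]
      ring
    simp only [he] at h5
    exact h5
  -- Only equality near 0 is assumed; uniqueness of power series identifies the coefficients with
  -- the Cauchy product.
  have huniq : ∀ n, a n = ∑ kl ∈ Finset.HasAntidiagonal.antidiagonal n, α kl.1 * (risingCoeff γ kl.2 : ℂ) := by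
    have hser : ∀ b : ℕ → ℂ, (∀ᶠ z : ℂ in 𝓝 0,
        HasSum (fun n => b n * z ^ n) ((1 - z) ^ (-γ : ℂ) * A z)) →
        HasFPowerSeriesAt (fun z : ℂ => (1 - z) ^ (-γ : ℂ) * A z)
          (FormalMultilinearSeries.ofScalars ℂ b) 0 := by
      intro b hb
      rw [hasFPowerSeriesAt_iff]
      filter_upwards [hb] with z hz
      simpa [FormalMultilinearSeries.coeff_ofScalars, mul_comm] using hz
    intro n
    have := (hser _ ha).eq_formalMultilinearSeries (hser _ hconv)
    have h := congrArg (fun p : FormalMultilinearSeries ℂ ℂ ℂ => p.coeff n) this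
    simpa [FormalMultilinearSeries.coeff_ofScalars] using h
  have h1 := tendsto_sum_antidiagonal_div_risingCoeff hγ hsum
  have h2 : ∑' k, α k = A 1 := by
    have := (hα 1 (by simpa using hr)).tsum_eq
    simpa using this
  rw [h2] at h1
  have h3 := (Complex.continuous_ofReal.tendsto _).comp (tendsto_risingCoeff hγ)
  have h4 := h1.mul h3
  rw [Complex.ofReal_inv, ← div_eq_mul_inv] at h4
  refine h4.congr fun n => ?_
  have : (risingCoeff γ n : ℂ) ≠ 0 := by exact_mod_cast (risingCoeff_pos hγ n).ne'
  rw [huniq n]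
  simp only [Function.comp_apply, Complex.ofReal_div]
  field_simp

/-- Coefficient asymptotics of a real power series equal to `(1 - z / R) ^ (-γ) * A z` near `0`,
with `A` holomorphic in a disc of radius larger than `R`. -/
theorem isEquivalent_coeff {A : ℂ → ℂ} {R r γ L : ℝ} (hR : 0 < R) (hr : R < r) (hγ : 0 < γ)
    (hA : DifferentiableOn ℂ A (Metric.ball 0 r)) {a : ℕ → ℝ}
    (ha : ∀ᶠ z : ℂ in 𝓝 0,
      HasSum (fun n => (a n : ℂ) * z ^ n) ((1 - z / R) ^ (-γ : ℂ) * A z))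
    (hL : A R = L) (hL0 : L ≠ 0) :
    a ~[atTop] fun n : ℕ => L / Real.Gamma γ * (n : ℝ) ^ (γ - 1) * R ^ (-(n : ℝ)) := by
  have hRc : (R : ℂ) ≠ 0 := by exact_mod_cast hR.ne'
  have hA' : DifferentiableOn ℂ (fun z => A (R * z)) (Metric.ball 0 (r / R)) := by
    refine hA.comp (by fun_prop) fun z hz => ?_
    rw [mem_ball_zero_iff] at hz ⊢
    rw [norm_mul, Complex.norm_real, Real.norm_of_nonneg hR.le]
    rwa [lt_div_iff₀' hR] at hz
  -- The substitution z ↦ R z moves the singularity to 1 and multiplies the coefficients by Rⁿ.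
  have h := coeff_asymptotics_one (a := fun n => ((a n * R ^ n : ℝ) : ℂ)) (γ := γ)
    ((one_lt_div hR).2 hr) hγ hA' (by
      have ht : Tendsto (fun z : ℂ => R * z) (𝓝 0) (𝓝 0) := by
        have hc : Continuous fun z : ℂ => R * z := by fun_prop
        simpa using hc.tendsto 0
      filter_upwards [ht.eventually ha] with z hz
      rw [mul_div_cancel_left₀ _ hRc] at hz
      convert hz using 2 with n
      push_cast
      rw [mul_pow]
      ring)
  rw [mul_one, hL] at h
  have h' : Tendsto (fun n : ℕ => a n * R ^ n / (n : ℝ) ^ (γ - 1)) atTop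
      (𝓝 (L / Real.Gamma γ)) := by
    have := (Complex.continuous_re.tendsto _).comp h
    rw [← Complex.ofReal_div, Complex.ofReal_re] at this
    refine this.congr fun n => ?_
    simp only [Function.comp_apply]
    rw [← Complex.ofReal_div, Complex.ofReal_re]
  have hLG : L / Real.Gamma γ ≠ 0 := div_ne_zero hL0 (Real.Gamma_pos_of_pos hγ).ne'
  refine isEquivalent_of_tendsto_one ?_
  have h1 := h'.div_const (L / Real.Gamma γ)
  rw [div_self hLG] at h1
  refine h1.congr fun n => ?_
  simp only [Pi.div_apply]
  rw [Real.rpow_neg hR.le, Real.rpow_natCast]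
  have := (pow_pos hR n).ne'
  field_simp

/-- A factor `(1 - z / R) ^ (-γ)` with `γ > 0` produces a dominant singularity at `R`. -/
theorem isDominantSingularity_of_eventuallyEq {A f : ℂ → ℂ} {R r γ : ℝ} (hR : 0 < R) (hr : R < r)
    (hγ : 0 < γ) (hA : DifferentiableOn ℂ A (Metric.ball 0 r)) (hAR : A R ≠ 0)
    (hf : (fun z : ℂ => (1 - z / R) ^ (-γ : ℂ) * A z) =ᶠ[𝓝 0] f) :
    IsDominantSingularity f R := by
  have hAan : ∀ z : ℂ, ‖z‖ ≤ R → AnalyticAt ℂ A z := fun z hz =>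
    hA.analyticAt (Metric.isOpen_ball.mem_nhds (by simpa using hz.trans_lt hr))
  refine ⟨hR, _, hf, fun z hz hzR => ?_, ?_⟩
  · refine AnalyticAt.mul (AnalyticAt.cpow (by fun_prop) analyticAt_const ?_) (hAan z hz)
    left
    -- In the closed disc the real part reaches R only at R itself. Elsewhere 1 - z/R lies in the
    -- open right half-plane, where the principal power is analytic.
    have hre : z.re < R := by
      refine lt_of_le_of_ne ((Complex.re_le_norm z).trans hz) fun h => hzR ?_
      have h1 : ‖z‖ = z.re := le_antisymm (h ▸ hz) (Complex.re_le_norm z)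
      have h2 : 0 ≤ z.re := h ▸ hR.le
      have h3 : z.im = 0 := by
        have := Complex.sq_norm_sub_sq_re z
        rw [h1, sub_self] at this
        exact pow_eq_zero_iff two_ne_zero |>.1 this.symm
      exact Complex.ext (by simpa using h) (by simpa using h3)
    have : (1 - z / (R : ℂ)).re = 1 - z.re / R := by simp [Complex.div_ofReal_re]
    rw [this, sub_pos, div_lt_one hR]
    exact hre
  -- Along the real radius the modulus tends to infinity because A R ≠ 0, whereas a continuation
  -- would have a finite limit.
  · rintro ⟨G, hG, hGF⟩
    have hto : Tendsto (fun x : ℝ => (x : ℂ)) (𝓝[<] R) (𝓝 (R : ℂ)) :=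
      (Complex.continuous_ofReal.tendsto R).mono_left nhdsWithin_le_nhds
    have hG1 := (hG.continuousAt.tendsto.comp hto).norm
    have hA1 := ((hAan R (by simp [abs_of_pos hR])).continuousAt.tendsto.comp hto).norm
    have hb : Tendsto (fun x : ℝ => 1 - x / R) (𝓝[<] R) (𝓝[>] 0) := by
      refine tendsto_nhdsWithin_iff.2 ⟨?_, ?_⟩
      · have : ContinuousAt (fun x : ℝ => 1 - x / R) R := by fun_prop
        have h := this.tendsto
        rw [div_self hR.ne', sub_self] at h
        exact h.mono_left nhdsWithin_le_nhds
      · filter_upwards [self_mem_nhdsWithin] with x hx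
        simpa [div_lt_one hR] using hx
    have hpow : Tendsto (fun x : ℝ => (1 - x / R) ^ (-γ)) (𝓝[<] R) atTop := by
      have h1 : Tendsto (fun y : ℝ => y ^ γ) (𝓝[>] 0) (𝓝[>] 0) := by
        refine tendsto_nhdsWithin_iff.2 ⟨?_, ?_⟩
        · have := (Real.continuousAt_rpow_const 0 γ (Or.inr hγ.le)).tendsto
          rw [Real.zero_rpow hγ.ne'] at this
          exact this.mono_left nhdsWithin_le_nhds
        · filter_upwards [self_mem_nhdsWithin] with x hx
          exact Real.rpow_pos_of_pos hx _
      refine ((tendsto_inv_nhdsGT_zero.comp h1).comp hb).congr' ?_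
      filter_upwards [hb.eventually self_mem_nhdsWithin] with x hx
      rw [Real.rpow_neg (le_of_lt hx)]
      rfl
    have hlim := hpow.atTop_mul_pos (norm_pos_iff.2 hAR) hA1
    refine not_tendsto_nhds_of_tendsto_atTop hlim _ (hG1.congr' ?_)
    have hpos : ∀ᶠ x : ℝ in 𝓝[<] R, 0 < x := nhdsWithin_le_nhds (lt_mem_nhds hR)
    filter_upwards [hto.eventually hGF, self_mem_nhdsWithin, hpos,
      hb.eventually self_mem_nhdsWithin] with x hx hxR hx0 hxb
    have hxR' : x < R := hxR
    simp only [Function.comp_apply]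
    rw [hx (by rwa [Complex.norm_real, Real.norm_of_nonneg hx0.le]), norm_mul]
    congr 1
    have : (1 - (x : ℂ) / (R : ℂ)) ^ (-γ : ℂ) = (((1 - x / R) ^ (-γ) : ℝ) : ℂ) := by
      rw [Complex.ofReal_cpow (le_of_lt hxb)]
      push_cast
      rfl
    rw [this, Complex.norm_real, Real.norm_of_nonneg (Real.rpow_nonneg (le_of_lt hxb) _)]

/-! ### Balance equations -/

/-- The residual service time (`0` when the server is free). -/
def residual : State → ℝ := Sum.elim (fun _ => 0) fun p => (p.2 : ℝ)

lemma measurable_residual : Measurable residual :=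
  measurable_const.sumElim (measurable_subtype_coe.comp measurable_snd)

lemma residual_nonneg (σ : State) : 0 ≤ residual σ := by
  rcases σ with n | ⟨n, x⟩
  · exact le_rfl
  · exact le_of_lt x.2

lemma measurable_orbit : Measurable orbit := by
  have : orbit = Sum.elim id Prod.fst := by
    funext σ
    rcases σ with n | ⟨n, x⟩ <;> rfl
  rw [this]
  exact measurable_id.sumElim measurable_fst

lemma measurableSet_free (n : ℕ) : MeasurableSet {σ : State | σ.isLeft ∧ orbit σ = n} := by
  refine MeasurableSet.inter ?_ (measurable_orbit (measurableSet_singleton n))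
  have : MeasurableSet (Set.range (Sum.inl : ℕ → State)) := measurableSet_range_inl
  rwa [Set.range_inl] at this

lemma measurableSet_busy (n : ℕ) : MeasurableSet {σ : State | σ.isRight ∧ orbit σ = n} := by
  refine MeasurableSet.inter ?_ (measurable_orbit (measurableSet_singleton n))
  have : MeasurableSet (Set.range (Sum.inr : ℕ × Set.Ioi (0 : ℝ) → State)) :=
    measurableSet_range_inr
  rwa [Set.range_inr] at this

/-- The Laplace transform of the residual service time on the event that the server is busy and
`n` customers are in orbit. -/
noncomputable def busyTransform (P : Measure State) (s : ℝ) (n : ℕ) : ℝ :=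
  ∫ σ in {σ : State | σ.isRight ∧ orbit σ = n}, Real.exp (-s * residual σ) ∂P

lemma integrable_exp_residual (P : Measure State) [IsProbabilityMeasure P] {s : ℝ} (hs : 0 ≤ s) :
    Integrable (fun σ => Real.exp (-s * residual σ)) P := by
  refine Integrable.of_bound (C := 1)
    (measurable_residual.const_mul (-s)).exp.aestronglyMeasurable ?_
  refine Eventually.of_forall fun σ => ?_
  rw [Real.norm_of_nonneg (Real.exp_pos _).le, Real.exp_le_one_iff]
  nlinarith [mul_nonneg hs (residual_nonneg σ)]

/-- Exponentials supported on one orbit level turn stationarity into equations for Laplace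
transforms; `0 ≤ s` keeps them bounded on the half-line. -/
lemma isTestFunction_exp {s : ℝ} (hs : 0 ≤ s) (n : ℕ) :
    IsTestFunction fun m x => if m = n then Real.exp (-s * x) else 0 := by
  refine ⟨fun m => ?_, fun m => ⟨1 + s, fun x hx => ?_⟩, ⟨n + 1, fun m hm x => ?_⟩⟩
  · split_ifs <;> fun_prop
  · split_ifs
    · have h1 : Real.exp (-s * x) ≤ 1 := by
        rw [Real.exp_le_one_iff]
        nlinarith [mul_nonneg hs hx]
      have h0 := Real.exp_pos (-s * x)
      have hd : deriv (fun x => Real.exp (-s * x)) x = Real.exp (-s * x) * -s := by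
        have : HasDerivAt (fun x => Real.exp (-s * x)) (Real.exp (-s * x) * (-s * 1)) x :=
          ((hasDerivAt_id x).const_mul (-s)).exp
        rw [this.deriv, mul_one]
      rw [hd, abs_of_pos h0, abs_mul, abs_of_pos h0, abs_neg, abs_of_nonneg hs]
      constructor <;> nlinarith
    · simp only [deriv_const', abs_zero]
      constructor <;> linarith
  · exact if_neg (by omega)

lemma generator_exp (lam nu : ℝ) (B : Measure ℝ) (s : ℝ) (n : ℕ) [IsProbabilityMeasure B] :
    generator lam nu B (fun m x => if m = n then Real.exp (-s * x) else 0) = fun σ =>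
      ({σ : State | σ.isLeft ∧ orbit σ = n}.indicator
        (fun _ => lam * (lst B s - 1) - n * nu) σ +
      {σ : State | σ.isLeft ∧ orbit σ = n + 1}.indicator
        (fun _ => (n + 1) * nu * lst B s) σ) +
      ({σ : State | σ.isRight ∧ orbit σ = n}.indicator
        (fun σ => (s - lam) * Real.exp (-s * residual σ)) σ +
      {σ : State | σ.isRight ∧ orbit σ + 1 = n}.indicator
        (fun σ => lam * Real.exp (-s * residual σ)) σ) := by
  have hlst : ∫ y, Real.exp (-s * y) ∂B = lst B s := rfl
  have hd : ∀ x, deriv (fun x => Real.exp (-s * x)) x = Real.exp (-s * x) * -s := by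
    intro x
    have : HasDerivAt (fun x => Real.exp (-s * x)) (Real.exp (-s * x) * (-s * 1)) x :=
      ((hasDerivAt_id x).const_mul (-s)).exp
    rw [this.deriv, mul_one]
  funext σ
  rcases σ with m | ⟨m, x⟩
  · simp only [generator, Set.indicator, Set.mem_ofPred_eq, Sum.isLeft_inl, Sum.isRight_inl, orbit,
      true_and]
    by_cases h1 : m = n
    · subst h1
      -- At m = 0 the truncated m - 1 is again 0, so the retrial term meets the same level; the rate
      -- m ν = 0 removes it.
      rcases Nat.eq_zero_or_pos m with rfl | hm
      · simp [hlst, -neg_mul]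
      · have : m - 1 ≠ m := by omega
        simp [hlst, this, -neg_mul]
        ring
    · by_cases h2 : m = n + 1
      · subst h2
        simp [hlst, -neg_mul]
      · rcases Nat.eq_zero_or_pos m with rfl | hm
        · simp [h1]
        · have : m - 1 ≠ n := by omega
          simp [h1, h2, this]
  · simp only [generator, Set.indicator, Set.mem_ofPred_eq, Sum.isLeft_inr, Sum.isRight_inr, orbit,
      true_and]
    by_cases h1 : m = n
    · subst h1
      simp [hd, residual, -neg_mul]
      ring
    · by_cases h2 : m + 1 = n
      · simp [h1, h2, residual]
      · simp [h1, h2]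

lemma balance_equation {lam nu : ℝ} {B : Measure ℝ} [IsProbabilityMeasure B] {P : Measure State}
    [IsProbabilityMeasure P] (hP : IsStationary lam nu B P) {s : ℝ} (hs : 0 ≤ s) (n : ℕ) :
    qProb P n * (lam * (lst B s - 1) - n * nu) + qProb P (n + 1) * ((n + 1) * nu * lst B s) +
      ((s - lam) * busyTransform P s n +
        lam * ∫ σ in {σ : State | σ.isRight ∧ orbit σ + 1 = n},
          Real.exp (-s * residual σ) ∂P) = 0 := by
  have h := hP _ (isTestFunction_exp hs n)
  -- Writing the lower level as orbit + 1 = n makes the set empty for n = 0, so no separate boundary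
  -- equation is needed.
  have hT : MeasurableSet {σ : State | σ.isRight ∧ orbit σ + 1 = n} := by
    rcases n with _ | n
    · simp
    · simpa using measurableSet_busy n
  have he := integrable_exp_residual P hs
  rw [generator_exp, integral_add, integral_add, integral_add,
    integral_indicator_const _ (measurableSet_free n),
    integral_indicator_const _ (measurableSet_free (n + 1)),
    integral_indicator (measurableSet_busy n), integral_indicator hT,
    integral_const_mul, integral_const_mul] at h
  · exact h
  · exact (he.const_mul _).indicator (measurableSet_busy n)
  · exact (he.const_mul _).indicator hT
  · exact (integrable_const _).indicator (measurableSet_free n)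
  · exact (integrable_const _).indicator (measurableSet_free (n + 1))
  · exact ((integrable_const _).indicator (measurableSet_free n)).add
      ((integrable_const _).indicator (measurableSet_free (n + 1)))
  · exact ((he.const_mul _).indicator (measurableSet_busy n)).add
      ((he.const_mul _).indicator hT)

lemma balance_zero {lam nu : ℝ} {B : Measure ℝ} [IsProbabilityMeasure B] {P : Measure State}
    [IsProbabilityMeasure P] (hP : IsStationary lam nu B P) {s : ℝ} (hs : 0 ≤ s) :
    qProb P 0 * (lam * (lst B s - 1)) + qProb P 1 * (nu * lst B s) +
      (s - lam) * busyTransform P s 0 = 0 := by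
  simpa using balance_equation hP hs 0

lemma balance_succ {lam nu : ℝ} {B : Measure ℝ} [IsProbabilityMeasure B] {P : Measure State}
    [IsProbabilityMeasure P] (hP : IsStationary lam nu B P) {s : ℝ} (hs : 0 ≤ s) (n : ℕ) :
    qProb P (n + 1) * (lam * (lst B s - 1) - (n + 1) * nu) +
      qProb P (n + 2) * ((n + 2) * nu * lst B s) +
      ((s - lam) * busyTransform P s (n + 1) + lam * busyTransform P s n) = 0 := by
  have h := balance_equation hP hs (n + 1)
  simp only [Nat.add_right_cancel_iff] at h
  have h2 : ((n + 1 : ℕ) : ℝ) + 1 = n + 2 := by push_cast; ring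
  rw [h2] at h
  push_cast at h
  exact h

lemma lst_zero (B : Measure ℝ) [IsProbabilityMeasure B] : lst B 0 = 1 := by simp [lst]

lemma busyTransform_zero (P : Measure State) (n : ℕ) : busyTransform P 0 n = rProb P n := by
  simp [busyTransform, rProb]

/-- The cut equation between the levels `n` and `n + 1` of the orbit. -/
lemma cut_equation {lam nu : ℝ} {B : Measure ℝ} [IsProbabilityMeasure B] {P : Measure State}
    [IsProbabilityMeasure P] (hP : IsStationary lam nu B P) (n : ℕ) :
    (n + 1) * nu * qProb P (n + 1) = lam * rProb P n := by
  induction n with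
  | zero =>
    -- At s = 0 the transforms reduce to `rProb`, and the balance equations telescope over the
    -- levels.
    have := balance_zero hP le_rfl
    rw [lst_zero, busyTransform_zero] at this
    push_cast
    linarith
  | succ n ih =>
    have := balance_succ hP le_rfl n
    rw [lst_zero, busyTransform_zero, busyTransform_zero] at this
    push_cast
    linarith

/-! ### Total mass, summability and the functional equation -/

lemma sum_prob_eq_one {ι : Type*} [Countable ι] {α : Type*} [MeasurableSpace α] (P : Measure α)
    [IsProbabilityMeasure P] {S : ι → Set α} (hS : ∀ i, MeasurableSet (S i))
    (hd : Pairwise (Function.onFun Disjoint S)) (hU : ⋃ i, S i = Set.univ) :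
    HasSum (fun i => P.real (S i)) 1 := by
  have h := measure_iUnion (μ := P) hd hS
  rw [hU, measure_univ] at h
  have hs := ENNReal.hasSum_toReal (f := fun i => P (S i)) (by rw [← h]; simp)
  have h1 : ∑' i, (P (S i)).toReal = 1 := by
    rw [← ENNReal.tsum_toReal_eq (fun i => measure_ne_top _ _), ← h]; simp
  rw [h1] at hs
  exact hs

lemma measurableSet_orbit (n : ℕ) : MeasurableSet {σ : State | orbit σ = n} :=
  measurable_orbit (measurableSet_singleton n)

lemma pProb_eq_add (P : Measure State) [IsProbabilityMeasure P] (n : ℕ) :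
    pProb P n = qProb P n + rProb P n := by
  unfold pProb qProb rProb
  rw [← measureReal_union _ (measurableSet_busy n)]
  · congr 1
    ext σ
    rcases σ with m | ⟨m, x⟩ <;> simp
  · rw [Set.disjoint_left]
    rintro (m | ⟨m, x⟩) <;> simp

lemma hasSum_pProb (P : Measure State) [IsProbabilityMeasure P] : HasSum (pProb P) 1 := by
  refine sum_prob_eq_one P measurableSet_orbit (fun i j hij => ?_) ?_
  · refine Set.disjoint_left.2 fun σ h1 h2 => hij ?_
    exact (h1 : orbit σ = i).symm.trans h2
  · ext σ
    simp

lemma summable_qProb (P : Measure State) [IsProbabilityMeasure P] : Summable (qProb P) :=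
  Summable.of_nonneg_of_le (fun _ => measureReal_nonneg)
    (fun n => by
      have : 0 ≤ rProb P n := measureReal_nonneg
      linarith [pProb_eq_add P n]) (hasSum_pProb P).summable

lemma summable_rProb (P : Measure State) [IsProbabilityMeasure P] : Summable (rProb P) :=
  Summable.of_nonneg_of_le (fun _ => measureReal_nonneg)
    (fun n => by
      have : 0 ≤ qProb P n := measureReal_nonneg
      linarith [pProb_eq_add P n]) (hasSum_pProb P).summable

lemma summable_mul_pow {a : ℕ → ℝ} (ha : Summable a) (h0 : ∀ n, 0 ≤ a n) {x : ℝ} (hx0 : 0 ≤ x)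
    (hx1 : x ≤ 1) : Summable fun n => a n * x ^ n :=
  Summable.of_nonneg_of_le (fun n => mul_nonneg (h0 n) (pow_nonneg hx0 n))
    (fun n => mul_le_of_le_one_right (h0 n) (pow_le_one₀ hx0 hx1)) ha

lemma busyTransform_nonneg (P : Measure State) (s : ℝ) (n : ℕ) : 0 ≤ busyTransform P s n :=
  integral_nonneg fun _ => (Real.exp_pos _).le

lemma busyTransform_le (P : Measure State) [IsProbabilityMeasure P] {s : ℝ} (hs : 0 ≤ s) (n : ℕ) :
    busyTransform P s n ≤ rProb P n := by
  rw [← busyTransform_zero]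
  refine integral_mono (integrable_exp_residual P hs).integrableOn
    (integrable_exp_residual P le_rfl).integrableOn fun σ => ?_
  refine Real.exp_le_exp.2 ?_
  nlinarith [mul_nonneg hs (residual_nonneg σ)]

/-- The functional equation of the generating functions. -/
theorem generating_function_equation {lam nu : ℝ} (hlam : 0 < lam) {B : Measure ℝ}
    [IsProbabilityMeasure B] {P : Measure State} [IsProbabilityMeasure P]
    (hP : IsStationary lam nu B P) {x : ℝ} (hx0 : 0 ≤ x) (hx1 : x ≤ 1) :
    (∑' n, rProb P n * x ^ n) * (lst B (lam * (1 - x)) - x) =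
      (∑' n, qProb P n * x ^ n) * (1 - lst B (lam * (1 - x))) := by
  -- This exponent gives s - λ = -λ x, so the terms with `busyTransform` on neighbouring levels
  -- cancel after weighting by xⁿ and summing.
  set s := lam * (1 - x) with hs_def
  have hs : 0 ≤ s := mul_nonneg hlam.le (by linarith)
  set b := lst B s
  have hq := summable_mul_pow (summable_qProb P) (fun _ => measureReal_nonneg) hx0 hx1
  have hr := summable_mul_pow (summable_rProb P) (fun _ => measureReal_nonneg) hx0 hx1
  have hM := summable_mul_pow (Summable.of_nonneg_of_le (busyTransform_nonneg P s)
    (busyTransform_le P hs) (summable_rProb P)) (busyTransform_nonneg P s) hx0 hx1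
  -- The cut equations eliminate ν, after which λ divides out.
  have e0 : (qProb P 0 + rProb P 0) * b - qProb P 0 - x * busyTransform P s 0 = 0 := by
    have h1 := balance_zero hP hs
    have h2 := cut_equation hP 0
    have : lam * ((qProb P 0 + rProb P 0) * b - qProb P 0 - x * busyTransform P s 0) = 0 := by
      push_cast at h2
      linear_combination h1 - b * h2 - busyTransform P s 0 * hs_def
    exact (mul_eq_zero.1 this).resolve_left hlam.ne'
  have e1 : ∀ n, (qProb P (n + 1) + rProb P (n + 1)) * b - qProb P (n + 1) - rProb P n
      - x * busyTransform P s (n + 1) + busyTransform P s n = 0 := by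
    intro n
    have h1 := balance_succ hP hs n
    have h2 := cut_equation hP n
    have h3 := cut_equation hP (n + 1)
    have : lam * ((qProb P (n + 1) + rProb P (n + 1)) * b - qProb P (n + 1) - rProb P n
        - x * busyTransform P s (n + 1) + busyTransform P s n) = 0 := by
      push_cast at h3
      linear_combination h1 - b * h3 + h2 - busyTransform P s (n + 1) * hs_def
    exact (mul_eq_zero.1 this).resolve_left hlam.ne'
  have tail : ∀ {a : ℕ → ℝ}, Summable (fun n => a n * x ^ n) →
      ∑' n, a n * x ^ n = a 0 + ∑' n, a (n + 1) * x ^ (n + 1) := by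
    intro a ha
    rw [ha.tsum_eq_zero_add]
    simp
  have hq' := (summable_nat_add_iff 1).2 hq
  have hr' := (summable_nat_add_iff 1).2 hr
  have hM' := (summable_nat_add_iff 1).2 hM
  have hsum : HasSum (fun n => ((qProb P (n + 1) + rProb P (n + 1)) * b - qProb P (n + 1)
      - rProb P n - x * busyTransform P s (n + 1) + busyTransform P s n) * x ^ (n + 1))
      (((∑' n, qProb P (n + 1) * x ^ (n + 1)) + ∑' n, rProb P (n + 1) * x ^ (n + 1)) * b
        - (∑' n, qProb P (n + 1) * x ^ (n + 1)) - (∑' n, rProb P n * x ^ n) * x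
        - x * (∑' n, busyTransform P s (n + 1) * x ^ (n + 1))
        + (∑' n, busyTransform P s n * x ^ n) * x) := by
    have := (((((hq'.hasSum.add hr'.hasSum).mul_right b).sub hq'.hasSum).sub
      (hr.hasSum.mul_right x)).sub (hM'.hasSum.mul_left x)).add (hM.hasSum.mul_right x)
    have he : ∀ n, ((qProb P (n + 1) + rProb P (n + 1)) * b - qProb P (n + 1)
        - rProb P n - x * busyTransform P s (n + 1) + busyTransform P s n) * x ^ (n + 1) =
        (qProb P (n + 1) * x ^ (n + 1) + rProb P (n + 1) * x ^ (n + 1)) * b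
        - qProb P (n + 1) * x ^ (n + 1) - rProb P n * x ^ n * x
        - x * (busyTransform P s (n + 1) * x ^ (n + 1)) + busyTransform P s n * x ^ n * x :=
      fun n => by ring
    simp only [he]
    exact this
  have h0 := hsum.unique (by simp only [e1, zero_mul]; exact hasSum_zero)
  have tq := tail hq
  have tr := tail hr
  have tM := tail hM
  linear_combination h0 + e0 + (b - 1) * tq + b * tr - x * tM

/-! ### The service time transform -/

section Transform

variable {B : Measure ℝ}

lemma mem_integrableExpSet_of_le (hBpos : ∀ᵐ x ∂B, 0 < x) {t u : ℝ}
    (hu : u ∈ integrableExpSet id B) (h : t ≤ u) : t ∈ integrableExpSet id B := by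
  refine Integrable.mono' (integrable_of_mem_integrableExpSet hu) (by fun_prop) ?_
  filter_upwards [hBpos] with x hx
  rw [Real.norm_of_nonneg (Real.exp_pos _).le, Real.exp_le_exp]
  exact mul_le_mul_of_nonneg_right h hx.le

lemma mem_interior_integrableExpSet (hBpos : ∀ᵐ x ∂B, 0 < x) {t u : ℝ}
    (hu : u ∈ integrableExpSet id B) (h : t < u) : t ∈ interior (integrableExpSet id B) :=
  mem_interior.2 ⟨Set.Iio u, fun _ hs => mem_integrableExpSet_of_le hBpos hu (le_of_lt hs),
    isOpen_Iio, h⟩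

lemma convexOn_mgf_id : ConvexOn ℝ (integrableExpSet id B) (mgf id B) := by
  refine ⟨convex_integrableExpSet, fun s hs t ht a b ha hb hab => ?_⟩
  have hst := convex_integrableExpSet hs ht ha hb hab
  have hs' := integrable_of_mem_integrableExpSet hs
  have ht' := integrable_of_mem_integrableExpSet ht
  simp only [mgf, smul_eq_mul]
  rw [← integral_const_mul, ← integral_const_mul,
    ← integral_add (hs'.const_mul a) (ht'.const_mul b)]
  refine integral_mono (integrable_of_mem_integrableExpSet hst)
    ((hs'.const_mul a).add (ht'.const_mul b)) fun x => ?_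
  have := convexOn_exp.2 (Set.mem_univ (s * x)) (Set.mem_univ (t * x)) ha hb hab
  simp only [smul_eq_mul] at this
  simp only [id]
  refine le_trans (le_of_eq ?_) this
  congr 1
  ring

lemma integral_pos_of_ae_pos [IsProbabilityMeasure B] {f : ℝ → ℝ} (hf : Integrable f B)
    (hpos : ∀ᵐ x ∂B, 0 < f x) : 0 < ∫ x, f x ∂B := by
  have h0 : 0 ≤ᵐ[B] f := hpos.mono fun x hx => hx.le
  refine lt_of_le_of_ne (integral_nonneg_of_ae h0) fun h => ?_
  have h1 := (integral_eq_zero_iff_of_nonneg_ae h0 hf).1 h.symm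
  obtain ⟨x, hx, hx'⟩ := (hpos.and h1).exists
  exact hx.ne' hx'

/-- When every exponential moment is finite, superlinear growth comes from eˣ ≥ 1 + x + x²/2 for x ≥
0 and a positive second moment. -/
lemma exists_mgf_gt_of_unbounded [IsProbabilityMeasure B] (hBpos : ∀ᵐ x ∂B, 0 < x)
    (hE : ∀ t, t ∈ integrableExpSet id B) {κ : ℝ} (hκ : 0 < κ) :
    ∃ t, 0 < t ∧ 1 + κ * t < mgf id B t := by
  have hint : (0 : ℝ) ∈ interior (integrableExpSet id B) :=
    mem_interior_integrableExpSet hBpos (hE 1) one_pos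
  have h1 : Integrable (fun x : ℝ => x) B := by
    simpa using integrable_pow_of_mem_interior_integrableExpSet hint 1
  have h2 : Integrable (fun x : ℝ => x ^ 2) B := by
    simpa using integrable_pow_of_mem_interior_integrableExpSet hint 2
  have hb := integral_pos_of_ae_pos h1 hBpos
  have hv := integral_pos_of_ae_pos h2 (hBpos.mono fun x hx => by positivity)
  set b := ∫ x, x ∂B
  set v := ∫ x, x ^ 2 ∂B
  -- Chosen so that the quadratic term t² v / 2 equals κ t; the positive linear term t b then makes
  -- the inequality strict.
  set t := 2 * κ / v with ht_def
  have ht : 0 < t := by positivity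
  refine ⟨t, ht, ?_⟩
  have hle : ∫ x, (1 + t * x + t ^ 2 / 2 * x ^ 2) ∂B ≤ mgf id B t := by
    refine integral_mono_ae (((integrable_const 1).add (h1.const_mul t)).add
      (h2.const_mul (t ^ 2 / 2))) (integrable_of_mem_integrableExpSet (hE t)) ?_
    filter_upwards [hBpos] with x hx
    have := Real.quadratic_le_exp_of_nonneg (mul_nonneg ht.le hx.le)
    simp only [id]
    linarith
  have heq : ∫ x, (1 + t * x + t ^ 2 / 2 * x ^ 2) ∂B = 1 + t * b + t ^ 2 / 2 * v := by
    have h12 : Integrable (fun x : ℝ => 1 + t * x) B := (integrable_const 1).add (h1.const_mul t)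
    rw [integral_add h12 (h2.const_mul (t ^ 2 / 2)), integral_add (integrable_const 1) (h1.const_mul t), integral_const_mul, integral_const_mul]
    simp [b, v]
  rw [heq] at hle
  have h3 : t ^ 2 / 2 * v = κ * t := by
    rw [ht_def]
    field_simp
  have := mul_pos ht hb
  linarith

/-- For a type-1 service time distribution the moment generating function overtakes every line
through `(0, 1)` inside its domain. -/
lemma exists_mgf_gt [IsProbabilityMeasure B] (hBpos : ∀ᵐ x ∂B, 0 < x) (hB : IsTypeOne B) {κ : ℝ}
    (hκ : 0 < κ) :
    ∃ t u, 0 < t ∧ t < u ∧ u ∈ integrableExpSet id B ∧ 1 + κ * t < mgf id B t := by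
  have hex : ∀ t : ℝ, (t : EReal) < lstRadius B → ∃ u ∈ integrableExpSet id B, t < u := by
    intro t ht
    simp only [lstRadius, lt_iSup_iff] at ht
    obtain ⟨u, hu, h⟩ := ht
    exact ⟨u, hu, by exact_mod_cast h⟩
  rcases eq_or_ne (lstRadius B) ⊤ with htop | htop
  · have hE : ∀ t, t ∈ integrableExpSet id B := fun t => by
      obtain ⟨u, hu, h⟩ := hex t (by rw [htop]; exact EReal.coe_lt_top t)
      exact mem_integrableExpSet_of_le hBpos hu h.le
    obtain ⟨t, ht, h⟩ := exists_mgf_gt_of_unbounded hBpos hE hκ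
    exact ⟨t, t + 1, ht, by linarith, hE _, h⟩
  · have hpos := hB.1
    obtain ⟨r, hr⟩ : ∃ r : ℝ, (r : EReal) = lstRadius B :=
      ⟨_, EReal.coe_toReal htop (ne_bot_of_gt hpos)⟩
    rw [← hr] at hpos hex
    have hlim := hB.2
    rw [← hr] at hlim
    -- The level 1 + κ r lies above the line on all of (0, r), so exceeding it at one point t < r
    -- suffices.
    have hev := eventually_comap.1 (hlim.eventually (eventually_gt_atTop (1 + κ * r)))
    have hne : (𝓝[<] (r : EReal)).NeBot := nhdsLT_neBot_of_exists_lt ⟨_, hpos⟩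
    obtain ⟨y, ⟨hy, hyr⟩, hy0⟩ := ((hev.and self_mem_nhdsWithin).and
      (nhdsWithin_le_nhds (lt_mem_nhds hpos))).exists
    have hyr' : y < r := hyr
    obtain ⟨t, rfl⟩ : ∃ t : ℝ, (t : EReal) = y :=
      ⟨_, EReal.coe_toReal (ne_top_of_lt hyr') (ne_bot_of_gt hy0)⟩
    obtain ⟨u, hu, htu⟩ := hex t hyr'
    refine ⟨t, u, by exact_mod_cast hy0, htu, hu, ?_⟩
    have h1 := hy t rfl
    simp only [lst, neg_neg] at h1
    have h2 : t < r := by exact_mod_cast hyr'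
    nlinarith

/-- The nontrivial intersection point of a convex moment generating function with a line. -/
lemma exists_mgf_eq [IsProbabilityMeasure B] (hBpos : ∀ᵐ x ∂B, 0 < x) (hB : IsTypeOne B) {κ : ℝ}
    (hκ : 0 < κ) (hmean : ∫ x, x ∂B < κ) :
    ∃ t u, 0 < t ∧ t < u ∧ u ∈ integrableExpSet id B ∧ mgf id B t = 1 + κ * t ∧
      κ < deriv (mgf id B) t ∧ ∀ s, 0 < s → s < t → mgf id B s < 1 + κ * s := by
  obtain ⟨t₁, u, ht₁, htu, hu, hgt⟩ := exists_mgf_gt hBpos hB hκ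
  have hsub : ∀ s, s < u → s ∈ interior (integrableExpSet id B) := fun s hs =>
    mem_interior_integrableExpSet hBpos hu hs
  have hd : ∀ s, s < u →
      HasDerivAt (fun s => mgf id B s - (1 + κ * s)) (deriv (mgf id B) s - κ) s := by
    intro s hs
    have h1 := (differentiableAt_mgf (hsub s hs)).hasDerivAt
    have h2 : HasDerivAt (fun s : ℝ => 1 + κ * s) κ s := by
      simpa using ((hasDerivAt_id s).const_mul κ).const_add 1
    exact h1.sub h2
  set g : ℝ → ℝ := fun s => mgf id B s - (1 + κ * s) with hg_def
  have hconv : ConvexOn ℝ (integrableExpSet id B) g := by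
    refine convexOn_mgf_id.sub ⟨convex_integrableExpSet, fun x _ y _ a b _ _ hab => ?_⟩
    simp only [smul_eq_mul]
    refine le_of_eq ?_
    linear_combination hab
  have hg0 : g 0 = 0 := by simp [hg_def]
  have hd0 : deriv (mgf id B) 0 - κ < 0 := by
    rw [deriv_mgf_zero (hsub 0 (by linarith))]
    simpa using hmean
  -- The mean is less than κ, so g leaves 0 with negative slope; a sign change before t₁ then
  -- produces the crossing t.
  have hneg : ∀ᶠ s in 𝓝[>] (0 : ℝ), g s < 0 := by
    have h := (hasDerivAt_iff_tendsto_slope.1 (hd 0 (by linarith))).mono_left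
      (nhdsWithin_mono 0 (fun x (hx : 0 < x) => ne_of_gt hx))
    filter_upwards [h.eventually (gt_mem_nhds hd0), self_mem_nhdsWithin] with s hs hs0
    rw [slope_def_field, hg0, sub_zero, sub_zero] at hs
    exact (div_neg_iff.1 hs).resolve_left (fun h => absurd h.2 (not_lt.2 (le_of_lt hs0))) |>.1
  have hcont : ContinuousOn g (Set.Iio u) := fun s hs => (hd s hs).continuousAt.continuousWithinAt
  have hs1 : ∀ᶠ s in 𝓝[>] (0 : ℝ), s < t₁ := nhdsWithin_le_nhds (gt_mem_nhds ht₁)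
  obtain ⟨s₀, ⟨hs₀g, hs₀t⟩, hs₀⟩ := ((hneg.and hs1).and self_mem_nhdsWithin).exists
  have hs₀ : 0 < s₀ := hs₀
  obtain ⟨t, ⟨hst, htt⟩, hgt0⟩ := intermediate_value_Icc hs₀t.le
    (hcont.mono fun x hx => lt_of_le_of_lt hx.2 htu) ⟨hs₀g.le, show 0 ≤ g t₁ by
      simp only [hg_def]; linarith⟩
  have hst' : s₀ < t := lt_of_le_of_ne hst fun h => by rw [h, hgt0] at hs₀g; exact lt_irrefl _ hs₀g
  have ht0 : 0 < t := hs₀.trans hst'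
  have htu' : t < u := htt.trans_lt htu
  have hE : ∀ s, s < u → s ∈ integrableExpSet id B := fun s hs => interior_subset (hsub s hs)
  -- Convexity puts g below its chords from 0 to s₀ and from s₀ to t, both negative inside (0, t).
  -- Hence t is the first crossing.
  have hbelow : ∀ s, 0 < s → s < t → g s < 0 := by
    intro s h0 h1
    rcases lt_trichotomy s s₀ with h | h | h
    · have := hconv.secant_mono_aux1 (hE 0 (by linarith)) (hE s₀ (by linarith)) h0 h
      rw [hg0] at this
      nlinarith
    · rw [h]
      exact hs₀g
    · have := hconv.secant_mono_aux1 (hE s₀ (by linarith)) (hE t htu') h h1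
      rw [hgt0] at this
      nlinarith
  refine ⟨t, u, ht0, htu', hu, by simp only [hg_def] at hgt0; linarith, ?_, fun s h0 h1 => ?_⟩
  -- The chord from s₀ to t has positive slope and the derivative at t is at least that slope. This
  -- transversality makes the pole of f₁ simple.
  · have := hconv.slope_le_of_hasDerivAt (hE s₀ (by linarith)) (hE t htu') hst' (hd t htu')
    rw [slope_def_field, hgt0, zero_sub] at this
    have h2 : 0 < -g s₀ / (t - s₀) := div_pos (by linarith) (by linarith)
    linarith
  · have := hbelow s h0 h1
    simp only [hg_def] at this
    linarith

lemma hasDerivAt_complexMGF_ofReal {t : ℝ} (ht : t ∈ interior (integrableExpSet id B)) :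
    HasDerivAt (complexMGF id B) ((deriv (mgf id B) t : ℝ) : ℂ) t := by
  have h := hasDerivAt_complexMGF (X := id) (μ := B) (z := t) (by simpa using ht)
  have he : ∫ x : ℝ, ((id x : ℝ) : ℂ) * Complex.exp (t * (id x : ℝ)) ∂B
      = ((deriv (mgf id B) t : ℝ) : ℂ) := by
    rw [deriv_mgf ht, ← integral_complex_ofReal]
    refine integral_congr_ae (Eventually.of_forall fun x => ?_)
    simp
  rw [he] at h
  exact h

/-- Mean value inequality on the closed left half-plane, which is convex and where the exponential
has modulus at most 1. -/
lemma norm_exp_sub_one_le_norm {w : ℂ} (hw : w.re ≤ 0) : ‖Complex.exp w - 1‖ ≤ ‖w‖ := by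
  have h := (convex_halfSpace_re_le 0).norm_image_sub_le_of_norm_hasDerivWithin_le
    (f := Complex.exp) (f' := Complex.exp) (C := 1) (x := 0) (y := w)
    (fun z _ => (Complex.hasDerivAt_exp z).hasDerivWithinAt)
    (fun z hz => by rw [Complex.norm_exp]; exact Real.exp_le_one_iff.2 hz) (by simp) hw
  simpa using h

lemma norm_complexMGF_sub_one_le [IsProbabilityMeasure B] (hBpos : ∀ᵐ x ∂B, 0 < x)
    (hint : Integrable (fun x : ℝ => x) B) {w : ℂ} (hw : w.re ≤ 0) :
    ‖complexMGF id B w - 1‖ ≤ ‖w‖ * ∫ x, x ∂B := by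
  have h0 : (0 : ℝ) ∈ integrableExpSet id B := by simp [integrableExpSet]
  have hi : Integrable (fun x : ℝ => Complex.exp (w * (id x : ℝ))) B :=
    integrable_cexp_mul_of_re_mem_integrableExpSet aemeasurable_id
      (mem_integrableExpSet_of_le hBpos h0 hw)
  have h1 : complexMGF id B w - 1 = ∫ x : ℝ, (Complex.exp (w * (id x : ℝ)) - 1) ∂B := by
    rw [integral_sub hi (integrable_const 1)]
    simp [complexMGF]
  rw [h1, ← integral_const_mul]
  refine norm_integral_le_of_norm_le (hint.const_mul _) ?_
  filter_upwards [hBpos] with x hx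
  refine (norm_exp_sub_one_le_norm ?_).trans ?_
  · simpa using mul_nonpos_of_nonpos_of_nonneg hw hx.le
  · rw [norm_mul, Complex.norm_real, id, Real.norm_of_nonneg hx.le]

/-- Used with κ = λ⁻¹ and w = λ(z - 1): a zero of B*(λ(1 - z)) - z with Re z ≤ 1 and z ≠ 1 would
turn the strict inequality into an equality. -/
lemma norm_complexMGF_sub_one_lt [IsProbabilityMeasure B] (hBpos : ∀ᵐ x ∂B, 0 < x)
    (hint : Integrable (fun x : ℝ => x) B) {κ : ℝ} (hmean : ∫ x, x ∂B < κ) {w : ℂ}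
    (hw : w.re ≤ 0) (hw0 : w ≠ 0) : ‖complexMGF id B w - 1‖ < κ * ‖w‖ := by
  refine (norm_complexMGF_sub_one_le hBpos hint hw).trans_lt ?_
  rw [mul_comm]
  exact mul_lt_mul_of_pos_right hmean (norm_pos_iff.2 hw0)

end Transform

/-! ### Zeros of B*(λ(1 - z)) - z in the closed disc -/

/-- `B*(λ (1 - z))`: the generating function of the number of arrivals during a service. -/
noncomputable def arrivalGF (lam : ℝ) (B : Measure ℝ) (z : ℂ) : ℂ := clst B (lam * (1 - z))

lemma arrivalGF_eq (lam : ℝ) (B : Measure ℝ) (z : ℂ) :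
    arrivalGF lam B z = complexMGF id B (lam * (z - 1)) := by
  rw [arrivalGF, clst]
  congr 1
  ring

lemma arrivalGF_ofReal (lam : ℝ) (B : Measure ℝ) (x : ℝ) :
    arrivalGF lam B x = (lst B (lam * (1 - x)) : ℝ) := by
  have : (lam : ℂ) * (x - 1) = ((lam * (x - 1) : ℝ) : ℂ) := by push_cast; ring
  rw [arrivalGF_eq, this, complexMGF_ofReal, lst]
  congr 2
  ring

lemma f1_eq (lam : ℝ) (B : Measure ℝ) (z : ℂ) :
    f1 lam B z = (1 - arrivalGF lam B z) / (arrivalGF lam B z - z) := rfl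

lemma hasDerivAt_arrivalGF {lam : ℝ} {B : Measure ℝ} {x : ℝ}
    (hx : lam * (x - 1) ∈ interior (integrableExpSet id B)) :
    HasDerivAt (arrivalGF lam B) ((lam * deriv (mgf id B) (lam * (x - 1)) : ℝ) : ℂ) x := by
  have h1 := hasDerivAt_complexMGF_ofReal hx
  have h2 : HasDerivAt (fun z : ℂ => (lam : ℂ) * (z - 1)) lam x := by
    simpa using ((hasDerivAt_id (x : ℂ)).sub_const 1).const_mul (lam : ℂ)
  have h3 : (lam : ℂ) * (x - 1) = ((lam * (x - 1) : ℝ) : ℂ) := by push_cast; ring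
  rw [← h3] at h1
  have h4 := h1.comp (x : ℂ) h2
  have h5 : arrivalGF lam B = complexMGF id B ∘ fun z : ℂ => (lam : ℂ) * (z - 1) :=
    funext fun z => arrivalGF_eq lam B z
  rw [h5, Complex.ofReal_mul, mul_comm (lam : ℂ)]
  exact h4

/-- The zero structure of `B*(λ (1 - z)) - z` in a closed disc. -/
theorem exists_zero_arrivalGF {B : Measure ℝ} [IsProbabilityMeasure B] (hBpos : ∀ᵐ x ∂B, 0 < x)
    (hB : IsTypeOne B) {lam : ℝ} (hlam : 0 < lam) (hstable : lam * ∫ x, x ∂B < 1) :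
    ∃ R r D : ℝ, 1 < R ∧ R < r ∧ IsLeast (zerosAboveOne lam B) R ∧
      DifferentiableOn ℂ (arrivalGF lam B) (Metric.ball 0 r) ∧
      (∀ z : ℂ, ‖z‖ ≤ R → z ≠ 1 → z ≠ R → arrivalGF lam B z ≠ z) ∧
      HasDerivAt (arrivalGF lam B) ((lam * ∫ x, x ∂B : ℝ) : ℂ) 1 ∧
      HasDerivAt (arrivalGF lam B) (D : ℂ) R ∧ 1 < D ∧ cf1 lam B R = (R - 1) / (D - 1) := by
  have hinv : 0 < lam⁻¹ := inv_pos.2 hlam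
  have hmean : ∫ x, x ∂B < lam⁻¹ := by
    rwa [← one_div, lt_div_iff₀' hlam]
  obtain ⟨t, u, ht, htu, hu, hteq, htd, hbelow⟩ := exists_mgf_eq hBpos hB hinv hmean
  have hsub : ∀ s, s < u → s ∈ interior (integrableExpSet id B) := fun s hs =>
    mem_interior_integrableExpSet hBpos hu hs
  have hint : Integrable (fun x : ℝ => x) B := by
    simpa using integrable_pow_of_mem_interior_integrableExpSet (hsub 0 (ht.trans htu)) 1
  have hlt : lam * (1 + lam⁻¹ * t - 1) = t := by field_simp; ring
  have hlst : ∀ x, lst B (lam * (1 - x)) = mgf id B (lam * (x - 1)) := fun x => by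
    rw [lst]
    congr 1
    ring
  have hb' : ∀ x : ℝ, 1 < x → x < 1 + lam⁻¹ * t → mgf id B (lam * (x - 1)) < x := by
    intro x h1 h2
    have h3 : x - 1 < lam⁻¹ * t := by linarith
    have h4 : lam * (x - 1) < t := by
      rw [← div_eq_inv_mul, lt_div_iff₀' hlam] at h3
      exact h3
    have := hbelow _ (mul_pos hlam (by linarith)) h4
    rwa [← mul_assoc, inv_mul_cancel₀ hlam.ne', one_mul, add_sub_cancel] at this
  have hR1 : 1 < 1 + lam⁻¹ * t := by linarith [mul_pos hinv ht]
  refine ⟨1 + lam⁻¹ * t, 1 + lam⁻¹ * u, lam * deriv (mgf id B) t, hR1, ?_, ⟨⟨hR1, ?_, ?_⟩, ?_⟩,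
    ?_, ?_, ?_, ?_, ?_, ?_⟩
  · linarith [mul_lt_mul_of_pos_left htu hinv]
  · rw [hlt]
    exact interior_subset (hsub t htu)
  · rw [hlst, hlt, hteq, sub_self]
  · rintro x ⟨hx1, hx2, hx3⟩
    by_contra hx
    have := hb' x hx1 (not_le.1 hx)
    rw [hlst] at hx3
    linarith
  · intro z hz
    have hz' : ‖z‖ < 1 + lam⁻¹ * u := by simpa using hz
    have hre : ((lam : ℂ) * (z - 1)).re < u := by
      rw [Complex.re_ofReal_mul, Complex.sub_re, Complex.one_re]
      have h1 : z.re - 1 < lam⁻¹ * u := by linarith [Complex.re_le_norm z]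
      rwa [← div_eq_inv_mul, lt_div_iff₀' hlam] at h1
    have h5 : arrivalGF lam B = complexMGF id B ∘ fun z : ℂ => (lam : ℂ) * (z - 1) :=
      funext fun z => arrivalGF_eq lam B z
    rw [h5]
    refine DifferentiableAt.differentiableWithinAt (DifferentiableAt.comp z ?_ (by fun_prop))
    exact (hasDerivAt_complexMGF (hsub _ hre)).differentiableAt
  · intro z hz hz1 hzR h
    rw [arrivalGF_eq] at h
    rcases le_or_gt z.re 1 with hre | hre
    · have h1 : ((lam : ℂ) * (z - 1)).re ≤ 0 := by
        rw [Complex.re_ofReal_mul, Complex.sub_re, Complex.one_re]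
        nlinarith
      have h2 := norm_complexMGF_sub_one_lt hBpos hint hmean h1
        (mul_ne_zero (by exact_mod_cast hlam.ne') (sub_ne_zero.2 hz1))
      rw [h, norm_mul, Complex.norm_real, Real.norm_of_nonneg hlam.le, ← mul_assoc,
        inv_mul_cancel₀ hlam.ne', one_mul] at h2
      exact lt_irrefl _ h2
    -- For 1 < Re z < R a zero would satisfy ‖z‖ ≤ mgf(λ(Re z - 1)) < Re z, since the real transform
    -- lies below the diagonal there.
    · have h1 : ‖z‖ ≤ mgf id B (lam * (z.re - 1)) := by
        have := norm_complexMGF_le_mgf (X := id) (μ := B) (z := (lam : ℂ) * (z - 1))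
        rwa [h, Complex.re_ofReal_mul, Complex.sub_re, Complex.one_re] at this
      have h2 : z.re < 1 + lam⁻¹ * t := by
        refine lt_of_le_of_ne ((Complex.re_le_norm z).trans hz) fun h => hzR ?_
        have h1 : ‖z‖ = z.re := le_antisymm (h ▸ hz) (Complex.re_le_norm z)
        have h3 : z.im = 0 := by
          have := Complex.sq_norm_sub_sq_re z
          rw [h1, sub_self] at this
          exact pow_eq_zero_iff two_ne_zero |>.1 this.symm
        exact Complex.ext (by rw [h, Complex.ofReal_re]) (by rw [h3, Complex.ofReal_im])
      have h3 := hb' z.re hre h2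
      linarith [Complex.re_le_norm z]
  · have h1 := hasDerivAt_arrivalGF (lam := lam) (B := B) (x := 1) (by
      rw [sub_self, mul_zero]
      exact hsub 0 (ht.trans htu))
    rw [sub_self, mul_zero, deriv_mgf_zero (hsub 0 (ht.trans htu))] at h1
    simpa using h1
  · have h1 := hasDerivAt_arrivalGF (lam := lam) (B := B) (x := 1 + lam⁻¹ * t) (by
      rw [hlt]; exact hsub t htu)
    rwa [hlt] at h1
  · rwa [← div_lt_iff₀' hlam, one_div]
  · have hlin : lam * (1 - (1 + lam⁻¹ * t)) = -t := by field_simp; ring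
    have hdl : deriv (lst B) (-t) = -deriv (mgf id B) t := by
      have h1 : HasDerivAt (mgf id B) (deriv (mgf id B) t) (-(-t)) := by
        rw [neg_neg]
        exact (differentiableAt_mgf (hsub t htu)).hasDerivAt
      have h2 := h1.comp (-t) (hasDerivAt_neg (-t))
      have h3 : lst B = mgf id B ∘ Neg.neg := rfl
      rw [h3, h2.deriv]
      ring
    rw [cf1, hlin, hdl, ← neg_div_neg_eq]
    congr 1 <;> ring

/-! ### Partial fraction decomposition at the dominant pole -/

/-- If `β` is holomorphic and `β z - z` has in the closed disc of radius `R` only the simple zeros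
`1` and `R`, with `β 1 = 1`, then `(1 - β z) / (β z - z)` has a simple pole at `R`, and no other
singularity in a larger disc. -/
theorem exists_pole_decomposition {β : ℂ → ℂ} {R r ρ D : ℝ} (hR : 1 < R) (hr : R < r)
    (hβ : DifferentiableOn ℂ β (Metric.ball 0 r)) (h1 : β 1 = 1) (hβR : β R = R)
    (hne : ∀ z : ℂ, ‖z‖ ≤ R → z ≠ 1 → z ≠ R → β z ≠ z)
    (hd1 : HasDerivAt β (ρ : ℂ) 1) (hρ : ρ < 1) (hdR : HasDerivAt β (D : ℂ) R) (hD : 1 < D) :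
    ∃ r' > R, ∃ h : ℂ → ℂ, DifferentiableOn ℂ h (Metric.ball 0 r') ∧
      (∀ z ∈ Metric.ball (0 : ℂ) r', z ≠ 1 → z ≠ R →
        (1 - β z) / (β z - z) = ((R - 1) / (D - 1) : ℝ) / (R - z) + h z) ∧
      ((R - 1) / (D - 1) : ℝ) / ((R : ℂ) - 1) + h 1 = ρ / (1 - ρ) := by
  have hR0 : 0 < R := by linarith
  have hball1 : Metric.ball (0 : ℂ) r ∈ 𝓝 (1 : ℂ) :=
    Metric.isOpen_ball.mem_nhds (by simpa using hR.trans hr)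
  have hballR : Metric.ball (0 : ℂ) r ∈ 𝓝 (R : ℂ) :=
    Metric.isOpen_ball.mem_nhds (by simpa [abs_of_pos hR0] using hr)
  have hRne : (R : ℂ) - 1 ≠ 0 := sub_ne_zero.2 (by exact_mod_cast hR.ne')
  have hDne : (D : ℂ) - 1 ≠ 0 := sub_ne_zero.2 (by exact_mod_cast hD.ne')
  have hρne : (ρ : ℂ) - 1 ≠ 0 := sub_ne_zero.2 (by exact_mod_cast hρ.ne)
  set D0 : ℂ → ℂ := fun z => β z - z with hD0
  have hD0d : DifferentiableOn ℂ D0 (Metric.ball 0 r) := hβ.sub differentiableOn_id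
  have hD01 : HasDerivAt D0 ((ρ : ℂ) - 1) 1 := hd1.sub (hasDerivAt_id _)
  have hD0R : HasDerivAt D0 ((D : ℂ) - 1) R := hdR.sub (hasDerivAt_id _)
  -- Dividing out the two zeros by successive slopes gives β z - z = (z - 1)(z - R) D2 z; simplicity
  -- of the zeros is the statement that D2 does not vanish at 1 and R.
  set D1 : ℂ → ℂ := dslope D0 1 with hD1
  have hD1d : DifferentiableOn ℂ D1 (Metric.ball 0 r) :=
    (Complex.differentiableOn_dslope hball1).2 hD0d
  have e0 : ∀ z, D0 z = (z - 1) * D1 z := fun z => by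
    have := sub_smul_dslope D0 1 z
    rw [smul_eq_mul] at this
    rw [hD1, this, hD0]
    simp [h1]
  have hD1R : D1 R = 0 := by
    have := e0 R
    rw [hD0] at this
    simp only [hβR, sub_self] at this
    exact (mul_eq_zero.1 this.symm).resolve_left hRne
  set D2 : ℂ → ℂ := dslope D1 R with hD2
  have hD2d : DifferentiableOn ℂ D2 (Metric.ball 0 r) :=
    (Complex.differentiableOn_dslope hballR).2 hD1d
  have e1 : ∀ z, D1 z = (z - R) * D2 z := fun z => by
    have := sub_smul_dslope D1 (R : ℂ) z
    rw [smul_eq_mul, hD1R, sub_zero] at this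
    exact this.symm
  have hD21 : (1 - (R : ℂ)) * D2 1 = ρ - 1 := by
    rw [← e1, hD1, dslope_same, hD01.deriv]
  have hD2R : ((R : ℂ) - 1) * D2 R = D - 1 := by
    have ha : HasDerivAt D1 (D2 R) R := by
      rw [hD2, dslope_same]
      exact (hD1d.differentiableAt hballR).hasDerivAt
    have hb := ((hasDerivAt_id (R : ℂ)).sub_const 1).mul ha
    have hc : D0 = (fun z => id z - 1) * D1 := funext fun z => e0 z
    rw [← hc] at hb
    have := hb.unique hD0R
    simpa [hD1R] using this
  have hD2ne : ∀ z ∈ Metric.closedBall (0 : ℂ) R, D2 z ≠ 0 := by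
    intro z hz h
    rcases eq_or_ne z 1 with rfl | hz1
    · rw [h, mul_zero] at hD21
      exact hρne hD21.symm
    · rcases eq_or_ne z R with rfl | hzR
      · rw [h, mul_zero] at hD2R
        exact hDne hD2R.symm
      · refine hne z (by simpa using hz) hz1 hzR (sub_eq_zero.1 ?_)
        have := e0 z
        rw [e1, h, mul_zero, mul_zero] at this
        exact this
  -- Compactness of the closed disc: D2 remains nonzero on a slightly larger one.
  obtain ⟨δ, hδ, hsub⟩ := (isCompact_closedBall (0 : ℂ) R).exists_thickening_subset_open
    (hD2d.continuousOn.isOpen_inter_preimage Metric.isOpen_ball isOpen_compl_singleton)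
    (fun z hz => ⟨Metric.closedBall_subset_ball hr hz, hD2ne z hz⟩ :
      Metric.closedBall (0 : ℂ) R ⊆ Metric.ball 0 r ∩ D2 ⁻¹' {0}ᶜ)
  rw [thickening_closedBall hδ hR0.le] at hsub
  have hsub1 : Metric.ball (0 : ℂ) (δ + R) ⊆ Metric.ball 0 r := fun z hz => (hsub hz).1
  have hD2ne' : ∀ z ∈ Metric.ball (0 : ℂ) (δ + R), D2 z ≠ 0 := fun z hz => (hsub hz).2
  set N : ℂ → ℂ := dslope (fun z => 1 - β z) 1 with hN
  have hNd : DifferentiableOn ℂ N (Metric.ball 0 r) :=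
    (Complex.differentiableOn_dslope hball1).2 ((differentiableOn_const 1).sub hβ)
  have eN : ∀ z, 1 - β z = (z - 1) * N z := fun z => by
    have := sub_smul_dslope (fun z => 1 - β z) 1 z
    rw [smul_eq_mul] at this
    rw [hN, this]
    simp [h1]
  -- The factor z - 1 cancels between numerator and denominator, so f₁ = g / (z - R); the slope of g
  -- at R is the holomorphic remainder.
  set g : ℂ → ℂ := fun z => N z / D2 z with hg
  have hgd : DifferentiableOn ℂ g (Metric.ball 0 (δ + R)) :=
    (hNd.mono hsub1).div (hD2d.mono hsub1) hD2ne'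
  have hballR' : Metric.ball (0 : ℂ) (δ + R) ∈ 𝓝 (R : ℂ) :=
    Metric.isOpen_ball.mem_nhds (by simpa [abs_of_pos hR0] using hδ)
  have hgR : g R = -(((R - 1) / (D - 1) : ℝ) : ℂ) := by
    have hNR : N R = -1 := by
      have := eN R
      rw [hβR] at this
      have h2 : ((R : ℂ) - 1) * N R = (R - 1) * (-1) := by rw [← this]; ring
      exact mul_left_cancel₀ hRne h2
    have h2 : D2 R = (D - 1) / (R - 1) := by rw [eq_div_iff hRne, mul_comm, hD2R]
    simp only [hg]
    rw [hNR, h2]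
    push_cast
    field_simp
  have eg : ∀ z, g z = -(((R - 1) / (D - 1) : ℝ) : ℂ) + (z - R) * dslope g R z := fun z => by
    have := sub_smul_dslope g (R : ℂ) z
    rw [smul_eq_mul, hgR] at this
    rw [this]
    ring
  refine ⟨δ + R, by linarith, dslope g R, (Complex.differentiableOn_dslope hballR').2 hgd, ?_, ?_⟩
  · intro z hz hz1 hzR
    have hz1' : z - 1 ≠ 0 := sub_ne_zero.2 hz1
    have hzR' : z - R ≠ 0 := sub_ne_zero.2 hzR
    have hzR'' : (R : ℂ) - z ≠ 0 := sub_ne_zero.2 hzR.symm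
    have h2 : (1 - β z) / (β z - z) = g z / (z - R) := by
      have := e0 z
      rw [eN, show β z - z = D0 z from rfl, this, e1, hg]
      have := hD2ne' z hz
      field_simp
    rw [h2, eg]
    field_simp
    ring
  · have h2 := eg 1
    have hN1 : N 1 = -ρ := by
      rw [hN, dslope_same]
      have := (hd1.const_sub 1).deriv
      exact this
    have hR1 : (1 : ℂ) - R ≠ 0 := by
      rw [← neg_sub]
      exact neg_ne_zero.2 hRne
    have h3 : D2 1 = (ρ - 1) / (1 - R) := by rw [eq_div_iff hR1, mul_comm, hD21]
    have h4 : (1 : ℂ) - ρ ≠ 0 := by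
      rw [← neg_sub]
      exact neg_ne_zero.2 hρne
    have h5 : g 1 = ρ * (1 - R) / (1 - ρ) := by
      simp only [hg]
      rw [hN1, h3]
      field_simp
      ring
    rw [h5] at h2
    generalize dslope g R 1 = w at h2 ⊢
    generalize (((R - 1) / (D - 1) : ℝ) : ℂ) = c at h2 ⊢
    field_simp
    field_simp at h2
    linear_combination h2

/-! ### Solving the differential equation -/

section GeneratingFunctions

variable {a : ℕ → ℝ}

lemma pgf_ofReal (a : ℕ → ℝ) (x : ℝ) : pgf a x = ((∑' n, a n * x ^ n : ℝ) : ℂ) := by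
  rw [pgf, Complex.ofReal_tsum]
  push_cast
  rfl

lemma norm_coeff_mul_pow_le (h0 : ∀ n, 0 ≤ a n) {z : ℂ} (hz : ‖z‖ ≤ 1) (n : ℕ) :
    ‖(a n : ℂ) * z ^ n‖ ≤ a n := by
  rw [norm_mul, Complex.norm_real, Real.norm_of_nonneg (h0 n), norm_pow]
  exact mul_le_of_le_one_right (h0 n) (pow_le_one₀ (norm_nonneg _) hz)

lemma hasSum_pgf (h0 : ∀ n, 0 ≤ a n) (ha : Summable a) {z : ℂ} (hz : ‖z‖ ≤ 1) :
    HasSum (fun n => (a n : ℂ) * z ^ n) (pgf a z) :=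
  (Summable.of_norm_bounded ha (norm_coeff_mul_pow_le h0 hz)).hasSum

lemma continuousOn_pgf (h0 : ∀ n, 0 ≤ a n) (ha : Summable a) :
    ContinuousOn (pgf a) (Metric.closedBall 0 1) :=
  continuousOn_tsum (fun n => by fun_prop) ha fun n z hz =>
    norm_coeff_mul_pow_le h0 (by simpa using hz) n

lemma tendsto_pgf_one (h0 : ∀ n, 0 ≤ a n) (ha : Summable a) :
    Tendsto (fun x : ℝ => pgf a x) (𝓝[<] 1) (𝓝 ((∑' n, a n : ℝ) : ℂ)) := by
  have h1 : pgf a ((1 : ℝ) : ℂ) = ((∑' n, a n : ℝ) : ℂ) := by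
    rw [pgf_ofReal]
    simp
  rw [← h1]
  refine ((continuousOn_pgf h0 ha) ((1 : ℝ) : ℂ) (by simp)).tendsto.comp ?_
  refine tendsto_nhdsWithin_iff.2
    ⟨(Complex.continuous_ofReal.tendsto 1).mono_left nhdsWithin_le_nhds, ?_⟩
  have : ∀ᶠ x : ℝ in 𝓝[<] 1, 0 < x := nhdsWithin_le_nhds (lt_mem_nhds one_pos)
  filter_upwards [self_mem_nhdsWithin, this] with x hx hx0
  rw [mem_closedBall_zero_iff, Complex.norm_real, Real.norm_of_nonneg hx0.le]
  exact le_of_lt hx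

/-- Termwise differentiation is dominated by n q(n), which the recursion identifies with a shift of
κ r(n) and hence makes summable. -/
lemma hasDerivAt_pgf {q r : ℕ → ℝ} {κ : ℝ} (hq0 : ∀ n, 0 ≤ q n) (hq : Summable q)
    (hr : Summable r) (hrec : ∀ n : ℕ, ((n : ℝ) + 1) * q (n + 1) = κ * r n)
    {z : ℂ} (hz : ‖z‖ < 1) : HasDerivAt (pgf q) (κ * pgf r z) z := by
  have hu : Summable fun n : ℕ => (n : ℝ) * q n := by
    rw [← summable_nat_add_iff 1]
    refine (hr.mul_left κ).congr fun n => ?_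
    rw [← hrec]
    push_cast
    rfl
  have hb : ∀ (n : ℕ) (y : ℂ), y ∈ Metric.ball (0 : ℂ) 1 →
      ‖(q n : ℂ) * (n * y ^ (n - 1))‖ ≤ n * q n := by
    intro n y hy
    have hy' : ‖y‖ < 1 := by simpa using hy
    rw [norm_mul, Complex.norm_real, Real.norm_of_nonneg (hq0 n), norm_mul, norm_pow,
      Complex.norm_natCast, mul_comm]
    refine mul_le_mul_of_nonneg_right ?_ (hq0 n)
    exact mul_le_of_le_one_right (by positivity) (pow_le_one₀ (norm_nonneg _) hy'.le)
  have hzb : z ∈ Metric.ball (0 : ℂ) 1 := by simpa using hz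
  have h := hasDerivAt_tsum_of_isPreconnected (g := fun n z => (q n : ℂ) * z ^ n)
    (g' := fun n z => (q n : ℂ) * (n * z ^ (n - 1))) hu Metric.isOpen_ball
    (convex_ball (0 : ℂ) 1).isPreconnected
    (fun n y _ => (hasDerivAt_pow n y).const_mul _) hb hzb
    (hasSum_pgf hq0 hq hz.le).summable hzb
  have hs : Summable fun n : ℕ => (q n : ℂ) * (n * z ^ (n - 1)) :=
    Summable.of_norm_bounded hu fun n => hb n z hzb
  have he : ∑' n : ℕ, (q n : ℂ) * (n * z ^ (n - 1)) = κ * pgf r z := by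
    rw [hs.tsum_eq_zero_add, pgf, ← tsum_mul_left]
    simp only [Nat.cast_zero, zero_mul, mul_zero, zero_add, Nat.add_sub_cancel]
    refine tsum_congr fun n => ?_
    have : (((n : ℝ) + 1) * q (n + 1) : ℝ) = ((κ * r n : ℝ) : ℂ) := by rw [hrec]
    push_cast at this
    rw [← mul_assoc, ← mul_assoc, ← this]
    push_cast
    ring
  rw [← he]
  exact h

end GeneratingFunctions

lemma one_sub_div_mem_slitPlane {R : ℝ} {z : ℂ} (hR : 0 < R) (hz : ‖z‖ < R) :
    1 - z / R ∈ Complex.slitPlane := by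
  left
  have : (1 - z / (R : ℂ)).re = 1 - z.re / R := by simp [Complex.div_ofReal_re]
  rw [this, sub_pos, div_lt_one hR]
  exact (Complex.re_le_norm z).trans_lt hz

/-- The fundamental solution of `G' = κ (c / (R - z) + h z) G`, where `h` has the primitive `H`. -/
lemma hasDerivAt_cpow_mul_exp {κ c R : ℝ} {h H : ℂ → ℂ} (hR : 0 < R) {z : ℂ} (hz : ‖z‖ < R)
    (hH : HasDerivAt H (h z) z) :
    HasDerivAt (fun z => (1 - z / R) ^ (-((κ * c : ℝ) : ℂ)) * Complex.exp (κ * H z))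
      (κ * (c / (R - z) + h z) *
        ((1 - z / R) ^ (-((κ * c : ℝ) : ℂ)) * Complex.exp (κ * H z))) z := by
  have hRc : (R : ℂ) ≠ 0 := by exact_mod_cast hR.ne'
  have hs := one_sub_div_mem_slitPlane hR hz
  have hne := Complex.slitPlane_ne_zero hs
  have hRz : (R : ℂ) - z ≠ 0 := by
    intro h0
    apply hne
    field_simp
    rw [mul_zero]
    exact h0
  have h1 : HasDerivAt (fun z : ℂ => 1 - z / R) (-(1 / R)) z :=
    ((hasDerivAt_id z).div_const (R : ℂ)).const_sub 1
  have h2 := h1.cpow_const (c := (-((κ * c : ℝ) : ℂ))) hs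
  have h3 := (hH.const_mul (κ : ℂ)).cexp
  refine (h2.mul h3).congr_deriv ?_
  rw [Complex.cpow_sub _ _ hne, Complex.cpow_one]
  have e : 1 - z / (R : ℂ) = (R - z) / R := by field_simp
  generalize (1 - z / (R : ℂ)) ^ (-((κ * c : ℝ) : ℂ)) = w
  generalize Complex.exp (κ * H z) = v
  rw [e]
  push_cast
  field_simp

/-- Explicit form of the generating functions near `0`. -/
theorem pgf_eventuallyEq {q r : ℕ → ℝ} {κ c R r' ρ : ℝ} {h H : ℂ → ℂ}
    (hq0 : ∀ n, 0 ≤ q n) (hq : Summable q) (hr0 : ∀ n, 0 ≤ r n) (hr : Summable r)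
    (hsum : ∑' n, q n + ∑' n, r n = 1)
    (hrec : ∀ n : ℕ, ((n : ℝ) + 1) * q (n + 1) = κ * r n) (hκ : 0 < κ) (hR : 1 < R) (hr' : R < r')
    (hρ : ρ < 1) (hH : ∀ z ∈ Metric.ball (0 : ℂ) r', HasDerivAt H (h z) z)
    (hh : ContinuousAt h 1)
    (hF : ∀ x : ℝ, 0 ≤ x → x < 1 → pgf r x = (c / (R - x) + h x) * pgf q x)
    (hF1 : (c : ℂ) / (R - 1) + h 1 = ρ / (1 - ρ)) :
    ∃ K : ℂ, K * ((1 - 1 / R) ^ (-((κ * c : ℝ) : ℂ)) * Complex.exp (κ * H 1)) = 1 - ρ ∧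
      pgf q =ᶠ[𝓝 0] (fun z => (1 - z / R) ^ (-((κ * c : ℝ) : ℂ)) *
        (K * Complex.exp (κ * H z))) ∧
      pgf r =ᶠ[𝓝 0] (fun z => (1 - z / R) ^ (-((1 + κ * c : ℝ) : ℂ)) *
        ((c / R + h z * (1 - z / R)) * (K * Complex.exp (κ * H z)))) := by
  have hR0 : 0 < R := by linarith
  have hRc : (R : ℂ) ≠ 0 := by exact_mod_cast hR0.ne'
  set G : ℂ → ℂ := fun z => (1 - z / R) ^ (-((κ * c : ℝ) : ℂ)) * Complex.exp (κ * H z) with hG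
  have hGd : ∀ z : ℂ, ‖z‖ < R → HasDerivAt G (κ * (c / (R - z) + h z) * G z) z := fun z hz =>
    hasDerivAt_cpow_mul_exp hR0 hz (hH z (by simpa using hz.trans hr'))
  have hGne : ∀ z : ℂ, ‖z‖ < R → G z ≠ 0 := fun z hz => by
    refine mul_ne_zero ?_ (Complex.exp_ne_zero _)
    rw [Ne, Complex.cpow_eq_zero_iff]
    exact fun h0 => Complex.slitPlane_ne_zero (one_sub_div_mem_slitPlane hR0 hz) h0.1
  have hQd : ∀ z : ℂ, ‖z‖ < 1 → HasDerivAt (pgf q) (κ * pgf r z) z := fun z hz =>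
    hasDerivAt_pgf hq0 hq hr hrec hz
  -- The relation between the two generating functions is available only for real x in [0, 1), so
  -- the quotient by the fundamental solution is shown constant there.
  have hW : ∀ x : ℝ, 0 ≤ x → x < 1 → HasDerivAt (fun x : ℝ => pgf q x / G x) 0 x := by
    intro x hx0 hx1
    have hx : ‖(x : ℂ)‖ < 1 := by rwa [Complex.norm_real, Real.norm_of_nonneg hx0]
    have h1 := ((hQd x hx).div (hGd x (hx.trans hR)) (hGne x (hx.trans hR))).comp_ofReal
    refine h1.congr_deriv ?_
    rw [hF x hx0 hx1, div_eq_zero_iff]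
    left
    ring
  set K : ℂ := pgf q (0 : ℝ) / G (0 : ℝ) with hK
  have hKx : ∀ x : ℝ, 0 ≤ x → x < 1 → pgf q x = K * G x := by
    intro x hx0 hx1
    have h1 := constant_of_has_deriv_right_zero (f := fun x : ℝ => pgf q x / G x) (a := 0) (b := x)
      (fun y hy => (hW y hy.1 (hy.2.trans_lt hx1)).continuousAt.continuousWithinAt)
      (fun y hy => (hW y hy.1 (hy.2.trans hx1)).hasDerivWithinAt) x ⟨hx0, le_rfl⟩
    have hx : ‖(x : ℂ)‖ < R := by
      rw [Complex.norm_real, Real.norm_of_nonneg hx0]; linarith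
    rw [hK, ← h1, div_mul_cancel₀ _ (hGne x hx)]
  have hone : ‖(1 : ℂ)‖ < R := by simpa using hR
  have hto : Tendsto (fun x : ℝ => (x : ℂ)) (𝓝[<] 1) (𝓝 1) := by
    have := (Complex.continuous_ofReal.tendsto 1).mono_left (nhdsWithin_le_nhds (s := Set.Iio 1))
    rwa [Complex.ofReal_one] at this
  have hpos : ∀ᶠ x : ℝ in 𝓝[<] 1, 0 < x := nhdsWithin_le_nhds (lt_mem_nhds one_pos)
  have hlimq := tendsto_pgf_one hq0 hq
  have hlimr := tendsto_pgf_one hr0 hr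
  have hQ1 : ((∑' n, q n : ℝ) : ℂ) = K * G 1 := by
    refine tendsto_nhds_unique hlimq
      ((((hGd 1 hone).continuousAt.tendsto.comp hto).const_mul K).congr' ?_)
    filter_upwards [self_mem_nhdsWithin, hpos] with x hx hx0
    exact (hKx x hx0.le hx).symm
  -- Letting x ↑ 1, the ratio of the two total masses is the value at 1 of the decomposed f₁, ρ / (1
  -- - ρ). Total mass one then forces Q(1) = 1 - ρ.
  have hR1 : ((∑' n, r n : ℝ) : ℂ) = (ρ / (1 - ρ)) * (∑' n, q n : ℝ) := by
    have hRne : (R : ℂ) - 1 ≠ 0 := sub_ne_zero.2 (by exact_mod_cast hR.ne')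
    have hcont : ContinuousAt (fun z : ℂ => c / (R - z) + h z) 1 :=
      (continuousAt_const.div (by fun_prop) hRne).add hh
    refine tendsto_nhds_unique hlimr ?_
    rw [← hF1]
    refine ((hcont.tendsto.comp hto).mul hlimq).congr' ?_
    filter_upwards [self_mem_nhdsWithin, hpos] with x hx hx0
    exact (hF x hx0.le hx).symm
  have hnorm : ((∑' n, q n : ℝ) : ℂ) = 1 - ρ := by
    have h1 : ((∑' n, q n : ℝ) : ℂ) + ((∑' n, r n : ℝ) : ℂ) = 1 := by exact_mod_cast hsum
    rw [hR1] at h1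
    have h2 : (1 : ℂ) - ρ ≠ 0 := sub_ne_zero.2 (by exact_mod_cast hρ.ne')
    field_simp at h1
    linear_combination h1
  have hqeq : pgf q =ᶠ[𝓝 0] fun z => K * G z := by
    have ha1 : AnalyticAt ℂ (pgf q) 0 :=
      DifferentiableOn.analyticAt (s := Metric.ball 0 1)
        (fun z hz => (hQd z (by simpa using hz)).differentiableAt.differentiableWithinAt)
        (Metric.ball_mem_nhds _ one_pos)
    have ha2 : AnalyticAt ℂ (fun z => K * G z) 0 :=
      DifferentiableOn.analyticAt (s := Metric.ball 0 R)
        (fun z hz => ((hGd z (by simpa using hz)).const_mul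
          K).differentiableAt.differentiableWithinAt)
        (Metric.ball_mem_nhds _ hR0)
    -- Identity theorem: agreement on small positive reals extends to a complex neighbourhood of 0.
    refine (ha1.frequently_eq_iff_eventually_eq ha2).1 ?_
    have hto0 : Tendsto (fun x : ℝ => (x : ℂ)) (𝓝[>] 0) (𝓝[≠] 0) := by
      refine tendsto_nhdsWithin_iff.2 ⟨?_, ?_⟩
      · have := (Complex.continuous_ofReal.tendsto 0).mono_left
          (nhdsWithin_le_nhds (s := Set.Ioi 0))
        rwa [Complex.ofReal_zero] at this
      · filter_upwards [self_mem_nhdsWithin] with x hx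
        have hx : 0 < x := hx
        simpa using hx.ne'
    refine hto0.frequently (Eventually.frequently ?_)
    have hlt : ∀ᶠ x : ℝ in 𝓝[>] 0, x < 1 := nhdsWithin_le_nhds (gt_mem_nhds one_pos)
    filter_upwards [self_mem_nhdsWithin, hlt] with x hx hx1
    exact hKx x (le_of_lt hx) hx1
  refine ⟨K, by rw [← hnorm, hQ1, hG], ?_, ?_⟩
  · filter_upwards [hqeq] with z hz
    rw [hz, hG]
    ring
  · filter_upwards [hqeq.eventuallyEq_nhds, Metric.ball_mem_nhds (0 : ℂ) one_pos] with z hz hzb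
    have hz1 : ‖z‖ < 1 := by simpa using hzb
    have hzR := hz1.trans hR
    have hκc : (κ : ℂ) ≠ 0 := by exact_mod_cast hκ.ne'
    have h1 := (hQd z hz1).congr_of_eventuallyEq hz.symm
    -- The second generating function is obtained for complex z from Q' = κ R(z), by differentiating
    -- the explicit Q.
    have h2 := h1.unique ((hGd z hzR).const_mul K)
    have h3 : pgf r z = (c / (R - z) + h z) * (K * G z) := by
      refine mul_left_cancel₀ hκc ?_
      rw [h2]
      ring
    have hne := Complex.slitPlane_ne_zero (one_sub_div_mem_slitPlane hR0 hzR)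
    have hexp : (1 - z / (R : ℂ)) ^ (-((1 + κ * c : ℝ) : ℂ)) =
        (1 - z / (R : ℂ))⁻¹ * (1 - z / R) ^ (-((κ * c : ℝ) : ℂ)) := by
      rw [Complex.ofReal_add, Complex.ofReal_one, neg_add, Complex.cpow_add _ _ hne,
        Complex.cpow_neg_one]
    rw [h3, hexp, hG]
    simp only
    generalize (1 - z / (R : ℂ)) ^ (-((κ * c : ℝ) : ℂ)) = w
    have hRz : (R : ℂ) - z ≠ 0 := by
      intro h0
      apply hne
      field_simp
      rw [mul_zero]
      exact h0
    have e : 1 - z / (R : ℂ) = (R - z) / R := by field_simp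
    rw [e]
    field_simp

/-! ### Order of the pole, the constant `cQ` and the amplitude at R -/

lemma meromorphicOrderAt_simple_pole {f h : ℂ → ℂ} {c : ℂ} {w : ℂ} (hc : c ≠ 0)
    (hh : AnalyticAt ℂ h w) (hf : ∀ᶠ z in 𝓝[≠] w, f z = c / (w - z) + h z) :
    meromorphicOrderAt f w = -1 := by
  have hg : AnalyticAt ℂ (fun z => -c + (z - w) * h z) w := by fun_prop
  have hfg : ∀ᶠ z in 𝓝[≠] w, f z = (z - w) ^ (-1 : ℤ) • (-c + (z - w) * h z) := by
    filter_upwards [hf, self_mem_nhdsWithin] with z hz hzw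
    have h1 : z - w ≠ 0 := sub_ne_zero.2 hzw
    have h2 : w - z ≠ 0 := sub_ne_zero.2 (Ne.symm hzw)
    rw [hz, zpow_neg_one, smul_eq_mul, ← neg_sub z w]
    field_simp
  have hm : MeromorphicAt f w := by
    refine MeromorphicAt.congr (f := fun z => (z - w) ^ (-1 : ℤ) • (-c + (z - w) * h z)) ?_ ?_
    · exact (AnalyticAt.meromorphicAt (by fun_prop : AnalyticAt ℂ (fun z => z - w) w)).zpow _ |>.smul hg.meromorphicAt
    · filter_upwards [hfg] with z hz
      exact hz.symm
  have := (meromorphicOrderAt_eq_int_iff (n := -1) hm).2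
    ⟨fun z => -c + (z - w) * h z, hg, by simpa using hc, hfg⟩
  exact_mod_cast this

/-- The integral in the constant `c_Q` in terms of a primitive of the holomorphic part of `f₁`. -/
lemma integral_cQIntegrand {lam : ℝ} {B : Measure ℝ} {R r : ℝ} {h H : ℂ → ℂ} (hR : 1 < R)
    (hr : R < r) (hh : DifferentiableOn ℂ h (Metric.ball 0 r))
    (hH : ∀ z ∈ Metric.ball (0 : ℂ) r, HasDerivAt H (h z) z)
    (hf : ∀ z ∈ Metric.ball (0 : ℂ) r, z ≠ 1 → z ≠ R →
      f1 lam B z = (cf1 lam B R : ℝ) / (R - z) + h z) :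
    IntervalIntegrable (cQIntegrand lam B R) volume R 1 ∧
      ((∫ x in R..1, cQIntegrand lam B R x : ℝ) : ℂ) = H 1 - H R := by
  have hball : ∀ x ∈ Set.uIcc R 1, (x : ℂ) ∈ Metric.ball (0 : ℂ) r := by
    intro x hx
    rw [Set.uIcc_of_ge hR.le] at hx
    rw [mem_ball_zero_iff, Complex.norm_real, Real.norm_of_nonneg (by linarith [hx.1])]
    exact hx.2.trans_lt hr
  have hcont : ContinuousOn (fun x : ℝ => h x) (Set.uIcc R 1) :=
    hh.continuousOn.comp Complex.continuous_ofReal.continuousOn hball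
  -- The endpoints are excluded: there the denominators vanish and division by zero takes its
  -- default value. The open interval suffices for the integral.
  have heq : ∀ x ∈ Set.uIoo R 1, h x = (cQIntegrand lam B R x : ℂ) := by
    intro x hx
    have hx' := hball x (Set.uIoo_subset_uIcc_self hx)
    rw [Set.uIoo_of_ge hR.le] at hx
    have h1 := hf x hx' (by exact_mod_cast hx.1.ne') (by exact_mod_cast hx.2.ne)
    rw [f1_eq, arrivalGF_ofReal] at h1
    rw [cQIntegrand]
    push_cast
    rw [h1]
    ring
  refine ⟨?_, ?_⟩
  · refine IntervalIntegrable.congr_uIoo (f := fun x : ℝ => (h x).re)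
      (Complex.continuous_re.comp_continuousOn hcont).intervalIntegrable fun x hx => ?_
    simp only
    rw [heq x hx, Complex.ofReal_re]
  · rw [← intervalIntegral.integral_ofReal,
      ← intervalIntegral.integral_congr_uIoo (f := fun x : ℝ => h x) heq]
    have := intervalIntegral.integral_eq_sub_of_hasDerivAt (a := R) (b := 1)
      (f := fun x : ℝ => H x) (f' := fun x : ℝ => h x)
      (fun x hx => (hH x (hball x hx)).comp_ofReal) hcont.intervalIntegrable
    rw [this]
    simp

lemma cQ_pos {lam nu : ℝ} {B : Measure ℝ} {R : ℝ} (hstable : lam * ∫ x, x ∂B < 1) (hR : 1 < R) :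
    0 < cQ lam nu B R :=
  mul_pos (mul_pos (by linarith) (Real.rpow_pos_of_pos (by linarith) _)) (Real.exp_pos _)

/-- The amplitude of the singularity at `R`. -/
lemma amplitude_eq {lam nu : ℝ} {B : Measure ℝ} {R : ℝ} {H : ℂ → ℂ} {K : ℂ} (hR : 1 < R)
    (hK : K * ((1 - 1 / (R : ℂ)) ^ (-((lam / nu * cf1 lam B R : ℝ) : ℂ)) *
      Complex.exp ((lam / nu : ℝ) * H 1)) = 1 - ((lam * ∫ x, x ∂B : ℝ) : ℂ))
    (hI : ((∫ x in R..1, cQIntegrand lam B R x : ℝ) : ℂ) = H 1 - H R) :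
    K * Complex.exp ((lam / nu : ℝ) * H R) =
      ((cQ lam nu B R * R ^ (-(lam / nu * cf1 lam B R)) : ℝ) : ℂ) := by
  have hR0 : 0 < R := by linarith
  set γ := lam / nu * cf1 lam B R with hγ
  have hb : (0 : ℝ) < 1 - 1 / R := by rw [sub_pos, div_lt_one hR0]; exact hR
  have hp : (1 - 1 / (R : ℂ)) ^ (-(γ : ℂ)) = (((1 - 1 / R) ^ (-γ) : ℝ) : ℂ) := by
    rw [Complex.ofReal_cpow hb.le]
    push_cast
    rfl
  -- The normalisation fixes K through H 1; the integral in `cQ` carries it from 1 to R.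
  have hH : H R = H 1 - ((∫ x in R..1, cQIntegrand lam B R x : ℝ) : ℂ) := by rw [hI]; ring
  have hrp : (1 - 1 / R) ^ (-γ) * ((R - 1) ^ γ * R ^ (-γ)) = 1 := by
    have h1 : 1 - 1 / R = (R - 1) / R := by field_simp
    have h2 : (R - 1) ^ γ ≠ 0 := (Real.rpow_pos_of_pos (by linarith) _).ne'
    have h3 : R ^ γ ≠ 0 := (Real.rpow_pos_of_pos hR0 _).ne'
    rw [h1, Real.div_rpow (by linarith) hR0.le, Real.rpow_neg (by linarith),
      Real.rpow_neg hR0.le]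
    field_simp
  rw [hp] at hK
  have hne : (((1 - 1 / R) ^ (-γ) : ℝ) : ℂ) ≠ 0 := by
    exact_mod_cast (Real.rpow_pos_of_pos hb _).ne'
  refine mul_left_cancel₀ hne ?_
  rw [hH, mul_sub, sub_eq_add_neg (_ * H 1), Complex.exp_add, cQ, ← hγ]
  have hrpc : (((1 - 1 / R) ^ (-γ) : ℝ) : ℂ) * ((((R - 1) ^ γ : ℝ) : ℂ) * ((R ^ (-γ) : ℝ) : ℂ)) =
      1 := by exact_mod_cast hrp
  have hexp : Complex.exp (-(((lam / nu : ℝ) : ℂ) *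
      ((∫ x in R..1, cQIntegrand lam B R x : ℝ) : ℂ))) =
      ((Real.exp (-(lam / nu) * ∫ x in R..1, cQIntegrand lam B R x) : ℝ) : ℂ) := by
    rw [Complex.ofReal_exp]
    congr 1
    rw [Complex.ofReal_mul, Complex.ofReal_neg]
    ring
  rw [hexp, Complex.ofReal_mul (_ * _), Complex.ofReal_mul, Complex.ofReal_mul (_ - _)]
  rw [Complex.ofReal_sub, Complex.ofReal_one]
  generalize ((Real.exp (-(lam / nu) * ∫ x in R..1, cQIntegrand lam B R x) : ℝ) : ℂ) = E
  linear_combination E * hK - (1 - ((lam * ∫ x, x ∂B : ℝ) : ℂ)) * E * hrpc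

end RetrialQueue

theorem mainTheorem10 (B : Measure ℝ) [IsProbabilityMeasure B] (hBpos : ∀ᵐ x ∂B, 0 < x)
    (hBtype : IsTypeOne B) (lam nu : ℝ) (hlam : 0 < lam) (hnu : 0 < nu)
    (hstable : lam * ∫ x, x ∂B < 1)
    (P : Measure State) [IsProbabilityMeasure P] (hP : IsStationary lam nu B P) :
    ∃ R : ℝ, IsLeast (zerosAboveOne lam B) R ∧
      meromorphicOrderAt (f1 lam B) (R : ℂ) = -1 ∧
      IsDominantSingularity (f1 lam B) R ∧
      IsDominantSingularity (pgf (qProb P)) R ∧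
      IsDominantSingularity (pgf (rProb P)) R ∧
      IsDominantSingularity (pgf (pProb P)) R ∧
      0 < cf1 lam B R ∧
      IntervalIntegrable (cQIntegrand lam B R) volume R 1 ∧
      qProb P ~[atTop] (fun n : ℕ =>
        cQ lam nu B R / Real.Gamma (lam / nu * cf1 lam B R) *
          (n : ℝ) ^ (lam / nu * cf1 lam B R - 1) *
          R ^ (-(n : ℝ) - lam / nu * cf1 lam B R)) ∧
      rProb P ~[atTop] (fun n : ℕ =>
        cQ lam nu B R * cf1 lam B R / Real.Gamma (1 + lam / nu * cf1 lam B R) *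
          (n : ℝ) ^ (lam / nu * cf1 lam B R) *
          R ^ (-(n : ℝ) - 1 - lam / nu * cf1 lam B R)) ∧
      pProb P ~[atTop] (fun n : ℕ =>
        cQ lam nu B R * cf1 lam B R / Real.Gamma (1 + lam / nu * cf1 lam B R) *
          (n : ℝ) ^ (lam / nu * cf1 lam B R) *
          R ^ (-(n : ℝ) - 1 - lam / nu * cf1 lam B R)) := by
  obtain ⟨R, r₀, D, hR, hr₀, hleast, hβd, hne, hd1, hdR, hD, hc_eq⟩ :=
    exists_zero_arrivalGF hBpos hBtype hlam hstable
  have hR0 : 0 < R := by linarith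
  have hRc : (R : ℂ) ≠ 0 := by exact_mod_cast hR0.ne'
  have hβ1 : arrivalGF lam B 1 = 1 := by
    have := arrivalGF_ofReal lam B 1
    rw [sub_self, mul_zero, lst_zero] at this
    simpa using this
  have hβR : arrivalGF lam B R = R := by
    rw [arrivalGF_ofReal, sub_eq_zero.1 hleast.1.2.2]
  obtain ⟨r, hr, h, hh, hf, hF1⟩ :=
    exists_pole_decomposition hR hr₀ hβd hβ1 hβR hne hd1 hstable hdR hD
  have hc : 0 < cf1 lam B R := by
    rw [hc_eq]
    exact div_pos (by linarith) (by linarith)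
  rw [← hc_eq] at hF1
  simp only [← hc_eq, ← f1_eq] at hf
  obtain ⟨H, hH⟩ := hh.isExactOn_ball
  obtain ⟨hint, hI⟩ := integral_cQIntegrand hR hr hh hH hf
  have hball : ∀ z : ℂ, ‖z‖ ≤ R → Metric.ball (0 : ℂ) r ∈ 𝓝 z := fun z hz =>
    Metric.isOpen_ball.mem_nhds (by simpa using hz.trans_lt hr)
  have hκ : 0 < lam / nu := div_pos hlam hnu
  have hγ : 0 < lam / nu * cf1 lam B R := mul_pos hκ hc
  have hq0 : ∀ n, 0 ≤ qProb P n := fun n => measureReal_nonneg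
  have hr0 : ∀ n, 0 ≤ rProb P n := fun n => measureReal_nonneg
  have hq := summable_qProb P
  have hrs := summable_rProb P
  have hpeq : pProb P = fun n => qProb P n + rProb P n := funext (pProb_eq_add P)
  have hsum : ∑' n, qProb P n + ∑' n, rProb P n = 1 := by
    rw [← hq.tsum_add hrs, ← hpeq]
    exact (hasSum_pProb P).tsum_eq
  have hrec : ∀ n : ℕ, ((n : ℝ) + 1) * qProb P (n + 1) = lam / nu * rProb P n := by
    intro n
    have := cut_equation hP n
    field_simp
    linear_combination this
  have hF : ∀ x : ℝ, 0 ≤ x → x < 1 → pgf (rProb P) x =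
      (cf1 lam B R / (R - x) + h x) * pgf (qProb P) x := by
    intro x hx0 hx1
    have hx : ‖(x : ℂ)‖ ≤ R := by
      rw [Complex.norm_real, Real.norm_of_nonneg hx0]
      linarith
    have h1 : (x : ℂ) ≠ 1 := by exact_mod_cast hx1.ne
    have h2 : (x : ℂ) ≠ R := by exact_mod_cast (hx1.trans hR).ne
    have h3 := generating_function_equation hlam hP hx0 hx1.le
    rw [← hf x (mem_of_mem_nhds (hball x hx)) h1 h2, f1_eq]
    have h4 : arrivalGF lam B x - x ≠ 0 := sub_ne_zero.2 (hne x hx h1 h2)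
    rw [div_mul_eq_mul_div, eq_div_iff h4, arrivalGF_ofReal, pgf_ofReal, pgf_ofReal]
    rw [mul_comm (1 - _)]
    exact_mod_cast h3
  obtain ⟨K, hK, hqeq, hreq⟩ := pgf_eventuallyEq hq0 hq hr0 hrs hsum hrec hκ hR hr hstable hH
    (hh.differentiableAt (hball 1 (by simpa using hR.le))).continuousAt hF hF1
  have hamp := amplitude_eq hR hK hI
  set γ := lam / nu * cf1 lam B R with hγ_def
  have hHd : DifferentiableOn ℂ H (Metric.ball 0 r) := fun z hz =>
    (hH z hz).differentiableAt.differentiableWithinAt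
  have hcQ := cQ_pos (nu := nu) hstable hR
  set Aq : ℂ → ℂ := fun z => K * Complex.exp ((lam / nu : ℝ) * H z) with hAq
  have hAqd : DifferentiableOn ℂ Aq (Metric.ball 0 r) := ((hHd.const_mul _).cexp).const_mul _
  -- Since c / (R - z) + h z = (1 - z/R)⁻¹ (c/R + h z (1 - z/R)), the busy generating function has
  -- exponent 1 + γ and amplitude c/R times that of Q.
  set Ar : ℂ → ℂ := fun z => (cf1 lam B R / R + h z * (1 - z / R)) * Aq z with hAr
  have hlin : DifferentiableOn ℂ (fun z : ℂ => 1 - z / R) (Metric.ball 0 r) := by fun_prop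
  have hAfd : DifferentiableOn ℂ (fun z => (cf1 lam B R : ℂ) / R + h z * (1 - z / R))
      (Metric.ball 0 r) := (hh.mul hlin).const_add _
  have hArd : DifferentiableOn ℂ Ar (Metric.ball 0 r) := hAfd.mul hAqd
  -- Over the common factor of exponent 1 + γ, the free part gains 1 - z/R and vanishes at R. Hence
  -- p₂ and r have the same leading term.
  set Ap : ℂ → ℂ := fun z => Ar z + (1 - z / R) * Aq z with hAp
  have hApd : DifferentiableOn ℂ Ap (Metric.ball 0 r) := hArd.add (hlin.mul hAqd)
  have hLq : cQ lam nu B R * R ^ (-γ) ≠ 0 := (mul_pos hcQ (Real.rpow_pos_of_pos hR0 _)).ne'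
  have hLr : cQ lam nu B R * cf1 lam B R * R ^ (-1 - γ) ≠ 0 :=
    (mul_pos (mul_pos hcQ hc) (Real.rpow_pos_of_pos hR0 _)).ne'
  have hArR : Ar R = ((cQ lam nu B R * cf1 lam B R * R ^ (-1 - γ) : ℝ) : ℂ) := by
    simp only [hAr]
    rw [div_self hRc, sub_self, mul_zero, add_zero, hAq]
    simp only
    rw [hamp, sub_eq_add_neg (-1), Real.rpow_add hR0, Real.rpow_neg_one]
    push_cast
    ring
  have hApR : Ap R = ((cQ lam nu B R * cf1 lam B R * R ^ (-1 - γ) : ℝ) : ℂ) := by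
    simp only [hAp]
    rw [div_self hRc, sub_self, zero_mul, add_zero, hArR]
  have hqeq' : pgf (qProb P) =ᶠ[𝓝 0] fun z => (1 - z / R) ^ (-(γ : ℂ)) * Aq z := hqeq
  have hreq' : pgf (rProb P) =ᶠ[𝓝 0] fun z => (1 - z / R) ^ (-((1 + γ : ℝ) : ℂ)) * Ar z := hreq
  have hone : ∀ᶠ z : ℂ in 𝓝 0, ‖z‖ < 1 := by
    filter_upwards [Metric.ball_mem_nhds (0 : ℂ) one_pos] with z hz
    simpa using hz
  have hpeq' : pgf (pProb P) =ᶠ[𝓝 0] fun z => (1 - z / R) ^ (-((1 + γ : ℝ) : ℂ)) * Ap z := by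
    filter_upwards [hqeq', hreq', hone] with z hzq hzr hz
    have h1 : pgf (pProb P) z = pgf (qProb P) z + pgf (rProb P) z := by
      have := ((hasSum_pgf hq0 hq hz.le).add (hasSum_pgf hr0 hrs hz.le)).tsum_eq
      rw [← this, pgf, hpeq]
      refine tsum_congr fun n => ?_
      push_cast
      ring
    have hne := Complex.slitPlane_ne_zero (one_sub_div_mem_slitPlane hR0 (hz.trans hR))
    have h2 : (1 - z / (R : ℂ)) ^ (-(γ : ℂ)) =
        (1 - z / (R : ℂ)) ^ (-((1 + γ : ℝ) : ℂ)) * (1 - z / R) := by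
      nth_rewrite 3 [← Complex.cpow_one (1 - z / (R : ℂ))]
      rw [← Complex.cpow_add _ _ hne]
      congr 1
      push_cast
      ring
    rw [h1, hzq, hzr, h2, hAp]
    ring
  -- The simple pole is the case of exponent 1, so the same singularity criterion covers f₁.
  have hfeq : (fun z : ℂ => (1 - z / R) ^ (-((1 : ℝ) : ℂ)) *
      (cf1 lam B R / R + h z * (1 - z / R))) =ᶠ[𝓝 0] f1 lam B := by
    filter_upwards [hone] with z hz
    have hzR := hz.trans hR
    have hne := Complex.slitPlane_ne_zero (one_sub_div_mem_slitPlane hR0 hzR)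
    have hz1 : z ≠ 1 := by
      rintro rfl
      simp at hz
    have hzR' : z ≠ R := by
      rintro rfl
      rw [Complex.norm_real, Real.norm_of_nonneg hR0.le] at hzR
      exact lt_irrefl _ hzR
    have hRz : (R : ℂ) - z ≠ 0 := sub_ne_zero.2 hzR'.symm
    rw [hf z (mem_of_mem_nhds (hball z hzR.le)) hz1 hzR', Complex.ofReal_one, Complex.cpow_neg_one]
    have e : 1 - z / (R : ℂ) = (R - z) / R := by field_simp
    rw [e]
    field_simp
  have hγ1 : 0 < 1 + γ := by linarith
  have hRn : ‖(R : ℂ)‖ ≤ R := by rw [Complex.norm_real, Real.norm_of_nonneg hR0.le]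
  have hhas : ∀ {a : ℕ → ℝ} {F : ℂ → ℂ}, (∀ n, 0 ≤ a n) → Summable a → pgf a =ᶠ[𝓝 0] F →
      ∀ᶠ z : ℂ in 𝓝 0, HasSum (fun n => (a n : ℂ) * z ^ n) (F z) := by
    intro a F h0 ha hF
    filter_upwards [hF, hone] with z hz hz1
    rw [← hz]
    exact hasSum_pgf h0 ha hz1.le
  have hcomb : ∀ {L : ℝ} {a : ℕ → ℝ},
      a ~[atTop] (fun n : ℕ => L * R ^ (-1 - γ) / Real.Gamma (1 + γ) * (n : ℝ) ^ (1 + γ - 1) *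
        R ^ (-(n : ℝ))) →
      a ~[atTop] fun n : ℕ => L / Real.Gamma (1 + γ) * (n : ℝ) ^ γ * R ^ (-(n : ℝ) - 1 - γ) := by
    intro L a ha
    refine ha.congr_right (Eventually.of_forall fun n => ?_)
    simp only
    rw [add_sub_cancel_left, show -(n : ℝ) - 1 - γ = (-1 - γ) + -(n : ℝ) by ring,
      Real.rpow_add hR0]
    ring
  have hp0 : ∀ n, 0 ≤ pProb P n := fun n => measureReal_nonneg
  refine ⟨R, hleast, ?_, ?_, ?_, ?_, ?_, hc, hint, ?_, ?_, ?_⟩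
  · refine meromorphicOrderAt_simple_pole (c := cf1 lam B R) (by exact_mod_cast hc.ne')
      (hh.analyticAt (hball R hRn)) ?_
    have h1 : ∀ᶠ z : ℂ in 𝓝[≠] (R : ℂ), z ≠ 1 :=
      nhdsWithin_le_nhds (isOpen_ne.mem_nhds (show (R : ℂ) ≠ 1 by exact_mod_cast hR.ne'))
    filter_upwards [nhdsWithin_le_nhds (hball R hRn), h1, self_mem_nhdsWithin] with z hz hz1 hzR
    exact hf z hz hz1 hzR
  · refine isDominantSingularity_of_eventuallyEq hR0 hr one_pos hAfd ?_ hfeq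
    rw [div_self hRc, sub_self, mul_zero, add_zero]
    exact div_ne_zero (by exact_mod_cast hc.ne') hRc
  · exact isDominantSingularity_of_eventuallyEq hR0 hr hγ hAqd
      (hamp.trans_ne (by exact_mod_cast hLq)) hqeq'.symm
  · exact isDominantSingularity_of_eventuallyEq hR0 hr hγ1 hArd
      (by rw [hArR]; exact_mod_cast hLr) hreq'.symm
  · exact isDominantSingularity_of_eventuallyEq hR0 hr hγ1 hApd
      (by rw [hApR]; exact_mod_cast hLr) hpeq'.symm
  · refine (isEquivalent_coeff hR0 hr hγ hAqd (hhas hq0 hq hqeq') hamp hLq).congr_right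
      (Eventually.of_forall fun n => ?_)
    simp only
    rw [show -(n : ℝ) - γ = -γ + -(n : ℝ) by ring, Real.rpow_add hR0]
    ring
  · exact hcomb (isEquivalent_coeff hR0 hr hγ1 hArd (hhas hr0 hrs hreq') hArR hLr)
  · exact hcomb (isEquivalent_coeff hR0 hr hγ1 hApd
      (hhas hp0 (hasSum_pProb P).summable hpeq') hApR hLr)
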